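/- Consider a cyclic polling system with queues $1,\dots,I$ and a single server. Customers arrive to queue $i$ according to a Poisson process of rate $\lambda_i>0$; the service times at queue $i$ are i.i.d. copies of a positive random variable $B_i$ with finite mean $1/\mu_i$; the gating indices of the successive visits to queue $i$ are i.i.d. copies of a random variable $X_i$ with values in $\{0,1,2,\dots\}\cup\{\infty\}$ and $\mathbb P(X_i=0)<1$. All arrival processes, service time sequences and gating index sequences are mutually independent. The server visits the queues in the cyclic order $1,\dots,I,1,\dots$ and works at unit rate. A visit to queue $i$ with gating index $g$ consists of successive gated phases, in each of which exactly the customers present in queue $i$ at the beginning of the phase are served; the visit ends as soon as $g$ phases have been carried out or queue $i$ is found empty at the end of a phase or at the beginning of the visit. A session consists of one (possibly empty) visit to each of the queues $1,\dots,I$ in this order, preceded, if the system is empty at the beginning of the session, by the waiting time until the first arrival. Let $\mathbf L_i=(L_{i,1},\dots,L_{i,I})$ (the session offspring of a queue $i$ customer) be the vector of queue lengths at the end of a session that begins with exactly one customer in the system, who is in queue $i$, and let $G$ be the distribution of the vector of queue lengths at the end of a session that begins with an empty system. Let $M=\{m_{i,j}\}_{i,j=1}^I$, $m_{i,j}=\mathbb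 E L_{i,j}$. Let $q_i$ be the extinction probability of the multitype branching process without immigration that starts from one individual of type $i$ and in which the offspring vector of an individual of type $j$ is distributed as $\mathbf L_j$, and let $q_G=\sum_{\mathbf k\in\mathbb Z_+^I}G(\mathbf k)\prod_{i=1}^I q_i^{k_i}$. Suppose that $\lambda_i/\mu_i<1$ for all $i$ and $\sum_{i=1}^I\lambda_i/\mu_i>1$. Then $M$ has finite entries and a Perron–Frobenius eigenvalue $\rho$, that is, a positive eigenvalue that is greater in absolute value than any other (complex) eigenvalue of $M$, and $\rho>1$. Moreover, $q_i<1$ for all $i$, and $q_G<1$. -/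

import Mathlib

open MeasureTheory ProbabilityTheory
open scoped NNReal

namespace Polling

/-! ### Sample-path dynamics of the cyclic polling system

For a fixed outcome, `a i t` is the number of arrivals to queue `i` during `[0, t]`, `b i k` is the
service time of the customer of queue `i` that is served as number `k` (counting from `0`), and
`x i n` is the gating index of visit `n` to queue `i`. The vector `c` is the queue content at
time `0`. Queues are labelled by `Fin I` and visited in increasing order within a session. -/

/-- The time, together with the number of departures from each queue up to that time. -/
abbrev State (I : ℕ) : Type := ℝ≥0 × (Fin I → ℕ)

section Dynamics

variable {I : ℕ} (a : Fin I → ℝ≥0 → ℕ) (b : Fin I → ℕ → ℝ≥0) (x : Fin I → ℕ → ℕ∞)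
  (c : Fin I → ℕ)

/-- Queue lengths: initial content plus arrivals minus departures. -/
def queue (s : State I) : Fin I → ℕ := fun j => c j + a j s.1 - s.2 j

/-- One gated service phase at queue `i`: exactly the customers present at the gating instant are
served. -/
noncomputable def phase (i : Fin I) (s : State I) : State I :=
  (s.1 + ∑ k ∈ Finset.range (queue a c s i), b i (s.2 i + k),
    Function.update s.2 i (s.2 i + queue a c s i))

/-- The number of gated phases during a visit to queue `i` with gating index `g`: the server leaves
as soon as the number of phases has reached `g` or the queue is found empty. (If neither ever
happens, the visit never ends, and the value is irrelevant.) -/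
noncomputable def phaseCount (g : ℕ∞) (i : Fin I) (s : State I) : ℕ :=
  sInf {k : ℕ | (k : ℕ∞) = g ∨ queue a c ((phase a b c i)^[k] s) i = 0}

/-- A whole visit to queue `i` with gating index `g`, started in the state `s`. -/
noncomputable def visit (g : ℕ∞) (i : Fin I) (s : State I) : State I :=
  (phase a b c i)^[phaseCount a b c g i s] s

open Classical in
/-- If the system is empty, the server waits for the next arrival, otherwise it starts to work at
once. -/
noncomputable def wait (s : State I) : State I :=
  if queue a c s = 0 then (sInf {u : ℝ≥0 | s.1 ≤ u ∧ queue a c (u, s.2) ≠ 0}, s.2) else s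

/-- Session `n`: waiting if the system is empty, and then one visit to each queue in turn. -/
noncomputable def session (n : ℕ) (s : State I) : State I :=
  (List.finRange I).foldl (fun s i => visit a b c (x i n) i s) (wait a c s)

/-- The state at the beginning of session `n`; session `0` begins at time `0`. -/
noncomputable def sessionStart : ℕ → State I
  | 0 => (0, 0)
  | n + 1 => session a b x c n (sessionStart n)

end Dynamics

/-! ### The stochastic model -/

/-- `N` is a Poisson process of rate `r`, with nondecreasing right-continuous paths. -/
structure IsPoissonProcess {Ω : Type*} [MeasurableSpace Ω] (P : Measure Ω) (r : ℝ≥0)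
    (N : ℝ≥0 → Ω → ℕ) : Prop where
  measurable : ∀ t, Measurable (N t)
  zero : ∀ ω, N 0 ω = 0
  mono : ∀ ω, Monotone (fun t => N t ω)
  right_cont : ∀ ω t, ContinuousWithinAt (fun u => N u ω) (Set.Ici t) t
  indep_increments : HasIndepIncrements N P
  law_increment : ∀ s h, HasLaw (fun ω => N (s + h) ω - N s ω) (poissonMeasure (r * h)) P

/-- The stochastic primitives of the cyclic polling model with `I` queues and multigated service:
arrival processes `arr i`, service times `srv i k` and gating indices `gate i n`, together with the
arrival rates `lam i` and service rates `mu i`. -/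
structure PollingModel (I : ℕ) {Ω : Type*} [MeasurableSpace Ω] (P : Measure Ω) where
  arr : Fin I → ℝ≥0 → Ω → ℕ
  srv : Fin I → ℕ → Ω → ℝ≥0
  gate : Fin I → ℕ → Ω → ℕ∞
  lam : Fin I → ℝ≥0
  mu : Fin I → ℝ
  lam_pos : ∀ i, 0 < lam i
  mu_pos : ∀ i, 0 < mu i
  arr_poisson : ∀ i, IsPoissonProcess P (lam i) (arr i)
  srv_measurable : ∀ i k, Measurable (srv i k)
  srv_pos : ∀ i k ω, 0 < srv i k ω
  srv_indep : ∀ i, iIndepFun (fun k => srv i k) P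
  srv_ident : ∀ i k, IdentDistrib (srv i k) (srv i 0) P P
  srv_integrable : ∀ i, Integrable (fun ω => (srv i 0 ω : ℝ)) P
  srv_mean : ∀ i, ∫ ω, (srv i 0 ω : ℝ) ∂P = 1 / mu i
  gate_measurable : ∀ i n, Measurable (gate i n)
  gate_indep : ∀ i, iIndepFun (fun n => gate i n) P
  gate_ident : ∀ i n, IdentDistrib (gate i n) (gate i 0) P P
  /-- All arrival processes, service time sequences and gating index sequences are mutually
  independent. -/
  indep : iIndep (Sum.elim (fun i => MeasurableSpace.comap (fun ω t => arr i t ω) inferInstance)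
    (Sum.elim (fun i => MeasurableSpace.comap (fun ω k => srv i k ω) inferInstance)
      (fun i => MeasurableSpace.comap (fun ω n => gate i n ω) inferInstance))) P

/-! ### Multitype branching processes -/

section Branching

variable {I : ℕ}

/-- Generation `n` of the multitype branching process that starts from one individual of type `i`,
when `y (n, j, k)` is the offspring vector of the `k`-th individual of type `j` in
generation `n`. -/
def generation (i : Fin I) (y : ℕ × Fin I × ℕ → Fin I → ℕ) : ℕ → Fin I → ℕ
  | 0 => Pi.single i 1
  | n + 1 => ∑ j, ∑ k ∈ Finset.range (generation i y n j), y (n, j, k)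

/-- The probability that the multitype branching process with offspring laws `ν j` that starts from
one individual of type `i` becomes extinct. The offspring vectors of all individuals are
independent, as coordinates of a product space. -/
noncomputable def extinctionProb (ν : Fin I → Measure (Fin I → ℕ)) (i : Fin I) : ℝ :=
  (Measure.infinitePi (fun p : ℕ × Fin I × ℕ => ν p.2.1)).real
    {y | ∃ n, generation i y n = 0}

end Branching

/-- `ρ` is the Perron-Frobenius eigenvalue of the square matrix `M`: a positive eigenvalue which is
greater in absolute value than any other (complex) eigenvalue of `M`. -/
def IsPerronFrobeniusEigenvalue {I : ℕ} (M : Matrix (Fin I) (Fin I) ℝ) (ρ : ℝ) : Prop :=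
  0 < ρ ∧ Module.End.HasEigenvalue (Matrix.toLin' M) ρ ∧
    ∀ z : ℂ, Module.End.HasEigenvalue (Matrix.toLin' (M.map (algebraMap ℝ ℂ))) z →
      z ≠ (ρ : ℂ) → ‖z‖ < ρ

/-! ### The embedded branching process of the polling model -/

namespace PollingModel

variable {I : ℕ} {Ω : Type*} [MeasurableSpace Ω] {P : Measure Ω} (m : PollingModel I P)

/-- The vector of queue lengths at the beginning of session `n`, if the queue lengths at time `0`
are `c`. -/
noncomputable def queueAt (c : Fin I → ℕ) (n : ℕ) (ω : Ω) : Fin I → ℕ :=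
  queue (fun i t => m.arr i t ω) c
    (sessionStart (fun i t => m.arr i t ω) (fun i k => m.srv i k ω) (fun i n => m.gate i n ω) c n)

/-- The session offspring of a customer of queue `i`: the queue lengths at the end of a session that
starts with this single customer in the system. -/
noncomputable def sessionOffspring (i : Fin I) : Ω → Fin I → ℕ := m.queueAt (Pi.single i 1) 1

/-- The mean session offspring matrix. -/
noncomputable def meanMatrix : Matrix (Fin I) (Fin I) ℝ :=
  Matrix.of fun i j => ∫ ω, (m.sessionOffspring i ω j : ℝ) ∂P

/-- The extinction probability of the branching process, without immigration, whose offspring is the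
session offspring and which starts from one individual of type `i`. -/
noncomputable def q (i : Fin I) : ℝ :=
  extinctionProb (fun j => P.map (m.sessionOffspring j)) i

/-- The immigration distribution: the law of the queue lengths at the end of a session at whose
beginning the system is empty. -/
noncomputable def immigration (k : Fin I → ℕ) : ℝ := P.real {ω | m.queueAt 0 1 ω = k}

/-- The return probability to the empty state. -/
noncomputable def qG : ℝ := ∑' k : Fin I → ℕ, m.immigration k * ∏ i, m.q i ^ k i

end PollingModel

/-! ### The session offspring is a random vector -/

section Measurability

variable {I : ℕ} {Ω : Type*} [MeasurableSpace Ω]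

lemma measurable_natSInf {p : ℕ → Ω → Prop} (hp : ∀ k, MeasurableSet {ω | p k ω}) :
    Measurable fun ω => sInf {k | p k ω} := by
  classical
  have hex : ∀ ω, ∃ k, p k ω ∨ ∀ j, ¬ p j ω := by
    intro ω
    by_cases h : ∃ k, p k ω
    · exact h.imp fun k hk => Or.inl hk
    · exact ⟨0, Or.inr (not_exists.1 h)⟩
  have hm := measurable_find hex (fun k => by
    have : {ω | p k ω ∨ ∀ j, ¬ p j ω} = {ω | p k ω} ∪ ⋂ j, {ω | p j ω}ᶜ := by
      ext ω; simp
    rw [this]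
    exact (hp k).union (MeasurableSet.iInter fun j => (hp j).compl))
  convert hm using 2 with ω
  by_cases h : ∃ k, p k ω
  · have hs : sInf {k | p k ω} = Nat.find h := Nat.sInf_def (s := {k | p k ω}) h
    rw [hs]
    apply le_antisymm
    · refine Nat.find_min' _ ?_
      rcases Nat.find_spec (hex ω) with h' | h'
      · exact h'
      · exact absurd h (not_exists.2 h')
    · exact Nat.find_min' _ (Or.inl (Nat.find_spec h))
  · have : {k | p k ω} = ∅ := by ext k; simpa using not_exists.1 h k
    rw [this, Nat.sInf_empty, eq_comm, Nat.find_eq_zero]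
    exact Or.inr (not_exists.1 h)

lemma measurable_natComp {β : Type*} [MeasurableSpace β] {f : ℕ → Ω → β}
    (hf : ∀ k, Measurable (f k)) {N : Ω → ℕ} (hN : Measurable N) :
    Measurable fun ω => f (N ω) ω := by
  have : Measurable fun p : ℕ × Ω => f p.1 p.2 := measurable_from_prod_countable_right hf
  exact this.comp (hN.prodMk measurable_id)

lemma IsPoissonProcess.measurable_comp {P : Measure Ω} {r : ℝ≥0} {N : ℝ≥0 → Ω → ℕ}
    (hN : IsPoissonProcess P r N) {T : Ω → ℝ≥0} (hT : Measurable T) :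
    Measurable fun ω => N (T ω) ω := by
  let S : ℕ → Ω → ℝ≥0 := fun n ω => ((⌊(n + 1 : ℝ≥0) * T ω⌋₊ : ℝ≥0) + 1) / (n + 1)
  have hS : ∀ n, Measurable fun ω => N (S n ω) ω := fun n =>
    measurable_natComp (f := fun k ω => N (((k : ℝ≥0) + 1) / (n + 1)) ω)
      (fun k => hN.measurable _) (Nat.measurable_floor.comp (hT.const_mul _))
  refine measurable_of_tendsto_metrizable hS (tendsto_pi_nhds.2 fun ω => ?_)
  have hle : ∀ n, T ω ≤ S n ω := fun n => by
    have h0 : (0 : ℝ≥0) < n + 1 := by positivity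
    rw [le_div_iff₀ h0, mul_comm]
    exact (Nat.lt_floor_add_one _).le
  have hub : ∀ n, S n ω ≤ T ω + 1 / (n + 1) := fun n => by
    have h0 : (0 : ℝ≥0) < n + 1 := by positivity
    have h1 : (T ω + 1 / (n + 1)) * (n + 1) = (n + 1) * T ω + 1 := by
      rw [add_mul, div_mul_cancel₀ _ h0.ne', mul_comm]
    rw [div_le_iff₀ h0, h1]
    gcongr
    exact Nat.floor_le (by positivity)
  have hlim : Filter.Tendsto (fun n => S n ω) Filter.atTop (nhds (T ω)) := by
    refine tendsto_of_tendsto_of_tendsto_of_le_of_le tendsto_const_nhds ?_ hle hub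
    have h1 : Filter.Tendsto (fun n : ℕ => (1 : ℝ≥0) / (n + 1)) Filter.atTop (nhds 0) :=
      tendsto_one_div_add_atTop_nhds_zero_nat
    simpa using tendsto_const_nhds.add h1
  exact (hN.right_cont ω (T ω)).tendsto.comp
    (tendsto_nhdsWithin_iff.2 ⟨hlim, Filter.Eventually.of_forall hle⟩)

variable {P : Measure Ω} (m : PollingModel I P) (c : Fin I → ℕ)

lemma measurable_queue {s : Ω → State I} (hs : Measurable s) :
    Measurable fun ω => queue (fun i t => m.arr i t ω) c (s ω) := by
  refine measurable_pi_iff.2 fun j => ?_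
  have h1 := (m.arr_poisson j).measurable_comp hs.fst
  have h2 : Measurable fun ω => (s ω).2 j := (measurable_pi_apply j).comp hs.snd
  exact ((measurable_const.add h1).sub h2 :)

lemma measurable_phase (i : Fin I) {s : Ω → State I} (hs : Measurable s) :
    Measurable fun ω =>
      phase (fun i t => m.arr i t ω) (fun i k => m.srv i k ω) c i (s ω) := by
  have hq := (measurable_pi_iff.1 (measurable_queue m c hs)) i
  have hd : Measurable fun ω => (s ω).2 i := (measurable_pi_apply i).comp hs.snd
  refine Measurable.prodMk (hs.fst.add ?_) ?_
  · refine measurable_natComp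
      (f := fun n ω => ∑ k ∈ Finset.range n, m.srv i ((s ω).2 i + k) ω) (fun n => ?_) hq
    refine Finset.measurable_sum _ fun k _ => ?_
    exact measurable_natComp (f := fun d ω => m.srv i (d + k) ω)
      (fun d => m.srv_measurable i _) hd
  · refine measurable_pi_iff.2 fun j => ?_
    by_cases h : j = i
    · subst h
      simp only [Function.update_self]
      exact hd.add hq
    · simp only [Function.update_of_ne h]
      exact (measurable_pi_apply j).comp hs.snd

lemma measurable_visit (n : ℕ) (i : Fin I) {s : Ω → State I} (hs : Measurable s) :
    Measurable fun ω =>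
      visit (fun i t => m.arr i t ω) (fun i k => m.srv i k ω) c (m.gate i n ω) i (s ω) := by
  have hit : ∀ k : ℕ, Measurable fun ω =>
      (phase (fun i t => m.arr i t ω) (fun i k => m.srv i k ω) c i)^[k] (s ω) := by
    intro k
    induction k with
    | zero => exact hs
    | succ k ih =>
      simp only [Function.iterate_succ_apply']
      exact measurable_phase m c i ih
  refine measurable_natComp hit (measurable_natSInf fun k => ?_)
  refine MeasurableSet.union ?_ ?_
  · exact m.gate_measurable i n (MeasurableSet.of_discrete (s := {g | (k : ℕ∞) = g}))
  · exact (measurable_pi_iff.1 (measurable_queue m c (hit k)) i) (measurableSet_singleton 0)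

lemma measurable_wait {s : Ω → State I} (hs : Measurable s) :
    Measurable fun ω => wait (fun i t => m.arr i t ω) c (s ω) := by
  refine Measurable.ite (measurable_queue m c hs (measurableSet_singleton 0)) ?_ hs
  refine Measurable.prodMk (measurable_of_Iio fun r => ?_) hs.snd
  let S : Ω → Set ℝ≥0 := fun ω =>
    {u | (s ω).1 ≤ u ∧ queue (fun i t => m.arr i t ω) c (u, (s ω).2) ≠ 0}
  have hS : ∀ u, MeasurableSet {ω | u ∈ S ω} := fun u =>
    (measurableSet_le hs.fst measurable_const).inter
      (measurable_queue m c (measurable_const.prodMk hs.snd) (measurableSet_singleton 0).compl)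
  have hup : ∀ ω u v, u ∈ S ω → u ≤ v → v ∈ S ω := by
    rintro ω u v ⟨h1, h2⟩ huv
    refine ⟨h1.trans huv, fun h => h2 (funext fun j => ?_)⟩
    have h3 := congrFun h j
    have h4 := (m.arr_poisson j).mono ω huv
    simp only [queue, Pi.zero_apply] at h3 h4 ⊢
    omega
  have hrat : ∀ ω (r : ℝ≥0), (∃ u ∈ S ω, u < r) ↔
      ∃ z : ℚ, Real.toNNReal z < r ∧ Real.toNNReal z ∈ S ω := by
    refine fun ω r => ⟨?_, fun ⟨z, h1, h2⟩ => ⟨_, h2, h1⟩⟩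
    rintro ⟨u, hu, hur⟩
    obtain ⟨z, -, h1, h2⟩ := (NNReal.lt_iff_exists_rat_btwn u r).1 hur
    exact ⟨z, h2, hup ω u _ hu h1.le⟩
  have hex : ∀ r : ℝ≥0, MeasurableSet {ω | ∃ u ∈ S ω, u < r} := by
    intro r
    simp only [hrat, Set.ofPred_exists]
    exact MeasurableSet.iUnion fun z => (MeasurableSet.const _).inter (hS _)
  have hne : MeasurableSet {ω | (S ω).Nonempty} := by
    have : {ω | (S ω).Nonempty} = ⋃ n : ℕ, {ω | ∃ u ∈ S ω, u < (n : ℝ≥0)} := by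
      ext ω
      simp only [Set.mem_ofPred_eq, Set.mem_iUnion]
      constructor
      · rintro ⟨u, hu⟩
        obtain ⟨n, hn⟩ := exists_nat_gt u
        exact ⟨n, u, hu, hn⟩
      · rintro ⟨n, u, hu, -⟩
        exact ⟨u, hu⟩
    rw [this]
    exact MeasurableSet.iUnion fun n => hex n
  have : (fun ω => sInf (S ω)) ⁻¹' Set.Iio r =
      {ω | ∃ u ∈ S ω, u < r} ∪ ({ω | (S ω).Nonempty}ᶜ ∩ {_ω | 0 < r}) := by
    ext ω
    by_cases h : (S ω).Nonempty
    · simp [h, csInf_lt_iff (OrderBot.bddBelow _) h]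
    · rw [Set.not_nonempty_iff_eq_empty] at h
      simp [h]
  change MeasurableSet ((fun ω => sInf (S ω)) ⁻¹' Set.Iio r)
  rw [this]
  exact (hex r).union (hne.compl.inter (MeasurableSet.const _))

lemma measurable_queueAt (n : ℕ) : Measurable (m.queueAt c n) := by
  refine measurable_queue m c ?_
  induction n with
  | zero => exact measurable_const
  | succ n ih =>
    have hf : ∀ (l : List (Fin I)) (s : Ω → State I), Measurable s → Measurable fun ω =>
        l.foldl (fun s i => visit (fun i t => m.arr i t ω) (fun i k => m.srv i k ω) c
          (m.gate i n ω) i s) (s ω) := by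
      intro l
      induction l with
      | nil => exact fun s hs => hs
      | cons i l ihl => exact fun s hs => ihl _ (measurable_visit m c n i hs)
    exact hf _ _ (measurable_wait m c ih)

end Measurability

end Polling

/-! Write `load i` for `lam i / mu i`. A gated phase at queue `i` replaces the customers present by
those arriving while they are served, so it multiplies the mean length of that queue by `load i`.
The gating index is independent of the state found, so a whole visit multiplies the mean by `gam i`,
the mean of `load i ^ X_i` with an infinite index contributing zero. Since `load i < 1` and `X_i` is
not almost surely zero, `gam i < 1` (`gam_lt_one`). Wald's identity for services and its analogue
for Poisson arrivals at stopping times give the mean length `tau i` of a visit per customer found,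
and every other queue `j` grows by `lam j * tau i` per such customer. Thus a visit acts linearly on
mean queue lengths (`Reachable.meanQueue_visit`), and row `i` of `meanMatrix` is the image of the
`i`-th unit vector under all visits in turn (`meanMatrix_apply`).

The test vector is the work `w j = 1 / mu j` brought by one customer. During a visit work leaves at
rate one and enters at rate `∑ load j > 1`, so mean work strictly increases in a session: `M w > w`
in every coordinate (`lt_sum_meanMatrix_mul`). Every column of `M` is positive or zero, since every
queue has positive mean before the last visit and receives arrivals during it; only the last queue
can have a zero column, when `gam` vanishes there (`meanMatrix_column`). For such matrices a
Collatz–Wielandt argument gives a dominant eigenvalue, and `M w > w` makes it exceed one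
(`exists_isPerronFrobeniusEigenvalue`).

The same inequality gives survival. For small `ε` the vector `1 - ε w` is a subsolution of the
generating function equation, because the first-order term in `ε` is `-M w < -w`; subsolutions bound
the extinction probabilities (`extinctionProb_le`). A session started from the empty system cannot
end empty almost surely, since its mean final work is positive, and so `q_G < 1`.

The probabilistic difficulty is to show that the random states met during a session are stopping
times for each primitive given the others. This is handled by `Observation` and `Reachable`. -/

namespace Polling

/-! ### Independence of σ-algebras and Wald's identity. -/

section IndependentSigmaAlgebras

variable {Ω : Type*} {m₁ m₂ m₃ mΩ : MeasurableSpace Ω} {P : Measure Ω}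

lemma isPiSystem_inter_measurableSets :
    IsPiSystem {s : Set Ω | ∃ A B, MeasurableSet[m₂] A ∧ MeasurableSet[m₃] B ∧ s = A ∩ B} := by
  rintro _ ⟨A, B, hA, hB, rfl⟩ _ ⟨A', B', hA', hB', rfl⟩ -
  exact ⟨A ∩ A', B ∩ B', hA.inter hA', hB.inter hB', Set.inter_inter_inter_comm A B A' B'⟩

lemma sup_eq_generateFrom_inter :
    m₂ ⊔ m₃ = MeasurableSpace.generateFrom
      {s : Set Ω | ∃ A B, MeasurableSet[m₂] A ∧ MeasurableSet[m₃] B ∧ s = A ∩ B} := by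
  apply le_antisymm
  · refine sup_le (fun A hA => ?_) (fun B hB => ?_)
    · exact MeasurableSpace.measurableSet_generateFrom
        ⟨A, Set.univ, hA, MeasurableSet.univ, (Set.inter_univ A).symm⟩
    · exact MeasurableSpace.measurableSet_generateFrom
        ⟨Set.univ, B, MeasurableSet.univ, hB, (Set.univ_inter B).symm⟩
  · refine MeasurableSpace.generateFrom_le ?_
    rintro _ ⟨A, B, hA, hB, rfl⟩
    exact MeasurableSet.inter ((le_sup_left : m₂ ≤ m₂ ⊔ m₃) _ hA)
      ((le_sup_right : m₃ ≤ m₂ ⊔ m₃) _ hB)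

/-- If `m₁` is independent of `m₂`, and both together are independent of `m₃`, then `m₁` is
independent of `m₂` and `m₃` together. -/
lemma Indep.sup_right [IsZeroOrProbabilityMeasure P] (h₁ : m₁ ≤ mΩ) (h₂ : m₂ ≤ mΩ) (h₃ : m₃ ≤ mΩ)
    (h₁₂ : Indep m₁ m₂ P) (h : Indep (m₁ ⊔ m₂) m₃ P) : Indep m₁ (m₂ ⊔ m₃) P := by
  refine IndepSets.indep h₁ (sup_le h₂ h₃) (@MeasurableSpace.isPiSystem_measurableSet Ω m₁)
    (isPiSystem_inter_measurableSets (m₂ := m₂) (m₃ := m₃))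
    (@MeasurableSpace.generateFrom_measurableSet Ω m₁).symm sup_eq_generateFrom_inter ?_
  rw [IndepSets_iff]
  rintro X _ hX ⟨A, B, hA, hB, rfl⟩
  have hX' : MeasurableSet[m₁ ⊔ m₂] X := (le_sup_left : m₁ ≤ m₁ ⊔ m₂) _ hX
  have hA' : MeasurableSet[m₁ ⊔ m₂] A := (le_sup_right : m₂ ≤ m₁ ⊔ m₂) _ hA
  rw [Indep_iff] at h h₁₂
  rw [← Set.inter_assoc, h _ _ (hX'.inter hA') hB, h₁₂ _ _ hX hA, h _ _ hA' hB, mul_assoc]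

lemma lintegral_indicator_of_indep {X : Ω → ENNReal} (h₁ : m₁ ≤ mΩ) (h₂ : m₂ ≤ mΩ)
    (hX : Measurable[m₁] X) (h : Indep m₁ m₂ P) {E : Set Ω} (hE : MeasurableSet[m₂] E) :
    ∫⁻ ω, E.indicator X ω ∂P = (∫⁻ ω, X ω ∂P) * P E := by
  have h' := lintegral_mul_eq_lintegral_mul_lintegral_of_independent_measurableSpace h₁ h₂ h hX
    (g := E.indicator fun _ => 1) (measurable_const.indicator hE)
  rw [lintegral_indicator_const (h₂ _ hE), one_mul] at h'
  rw [← h']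
  refine lintegral_congr fun ω => ?_
  by_cases hω : ω ∈ E <;> simp [hω]

lemma tsum_indicator_lt (n : ℕ) (f : ℕ → ENNReal) :
    ∑' k, (if k < n then f k else 0) = ∑ k ∈ Finset.range n, f k := by
  rw [tsum_eq_sum (s := Finset.range n)]
  · exact Finset.sum_congr rfl fun k hk => if_pos (Finset.mem_range.1 hk)
  · exact fun k hk => if_neg (by simpa using hk)

/-- Wald's identity for nonnegative summands, when the event `N ≤ k` does not depend on the
summand number `k`. -/
lemma wald [IsProbabilityMeasure P] {X : ℕ → Ω → ENNReal} {β : ENNReal} {N : Ω → ℕ}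
    (hN : Measurable N) (hX : ∀ k, Measurable (X k)) (hβ : ∀ k, ∫⁻ ω, X k ω ∂P = β)
    (hind : ∀ k, ∃ 𝓗 : MeasurableSpace Ω, 𝓗 ≤ mΩ ∧
      Indep (MeasurableSpace.comap (X k) inferInstance) 𝓗 P ∧
      ∃ E, MeasurableSet[𝓗] E ∧ ∀ᵐ ω ∂P, N ω ≤ k ↔ ω ∈ E) :
    ∫⁻ ω, ∑ k ∈ Finset.range (N ω), X k ω ∂P = β * ∫⁻ ω, (N ω : ENNReal) ∂P := by
  have hmeas : ∀ k, MeasurableSet {ω | k < N ω} := fun k => measurableSet_lt measurable_const hN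
  -- The event `k < N` is the complement of an event of `𝓗`, so it is independent of `X k`.
  have hterm : ∀ k, ∫⁻ ω, (if k < N ω then X k ω else 0) ∂P = β * P {ω | k < N ω} := by
    intro k
    obtain ⟨𝓗, h𝓗, hi, E, hE, hNE⟩ := hind k
    have h1 : ∫⁻ ω, (if k < N ω then X k ω else 0) ∂P = ∫⁻ ω, (Eᶜ).indicator (X k) ω ∂P := by
      refine lintegral_congr_ae ?_
      filter_upwards [hNE] with ω hω
      by_cases h : ω ∈ E
      · have : ¬ k < N ω := not_lt.2 (hω.2 h)
        simp [h, this]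
      · have : k < N ω := not_le.1 fun h' => h (hω.1 h')
        simp [h, this]
    have h2 : P {ω | k < N ω} = P Eᶜ := by
      refine measure_congr ?_
      filter_upwards [hNE] with ω hω
      change (k < N ω) = (ω ∈ Eᶜ)
      rw [Set.mem_compl_iff, ← hω, not_le]
    rw [h1, h2, lintegral_indicator_of_indep (hX k).comap_le h𝓗 (comap_measurable (X k)) hi
      hE.compl, hβ]
  have h1 : ∫⁻ ω, ∑ k ∈ Finset.range (N ω), X k ω ∂P
      = ∑' k, ∫⁻ ω, (if k < N ω then X k ω else 0) ∂P := by
    rw [← lintegral_tsum fun k => (Measurable.ite (hmeas k) (hX k) measurable_const).aemeasurable]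
    simp_rw [tsum_indicator_lt]
  have h2 : ∫⁻ ω, (N ω : ENNReal) ∂P = ∑' k, P {ω | k < N ω} := by
    have : ∀ ω, (N ω : ENNReal) = ∑' k, (if k < N ω then 1 else 0) := fun ω => by
      rw [tsum_indicator_lt]; simp
    simp_rw [this]
    rw [lintegral_tsum fun k => (Measurable.ite (hmeas k) measurable_const
      measurable_const).aemeasurable]
    refine tsum_congr fun k => ?_
    rw [← lintegral_indicator_one (hmeas k)]
    exact lintegral_congr fun ω => by simp [Set.indicator_apply]
  rw [h1, h2, ← ENNReal.tsum_mul_left]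
  exact tsum_congr hterm

end IndependentSigmaAlgebras


/-! ### Poisson processes at stopping times. -/

section Poisson

lemma lintegral_id_poissonMeasure (r : ℝ≥0) :
    ∫⁻ n, (n : ENNReal) ∂(poissonMeasure r) = r := by
  rw [poissonMeasure, lintegral_sum_measure]
  simp_rw [lintegral_smul_measure, lintegral_dirac]
  rw [tsum_eq_zero_add' ENNReal.summable]
  have hstep : ∀ n : ℕ, ENNReal.ofReal (Real.exp (-r) * r ^ (n + 1) / (n + 1).factorial) •
      ((n + 1 : ℕ) : ENNReal) = r * ENNReal.ofReal (Real.exp (-r) * r ^ n / n.factorial) := by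
    intro n
    have h0 : ((n + 1 : ℕ) : ENNReal) = ENNReal.ofReal ((n + 1 : ℕ) : ℝ) :=
      (ENNReal.ofReal_natCast _).symm
    have h1 : (r : ENNReal) = ENNReal.ofReal (r : ℝ) := by simp
    rw [h0, h1, smul_eq_mul, ← ENNReal.ofReal_mul (by positivity),
      ← ENNReal.ofReal_mul (by positivity)]
    congr 1
    rw [Nat.factorial_succ]
    push_cast
    have : (n.factorial : ℝ) ≠ 0 := by positivity
    field_simp
    ring
  simp only [hstep, ENNReal.tsum_mul_left]
  rw [← ENNReal.ofReal_tsum_of_nonneg (fun n => by positivity)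
      (hasSum_one_poissonMeasure r).summable,
    (hasSum_one_poissonMeasure r).tsum_eq]
  simp

variable {Ω : Type*} {𝓞 : MeasurableSpace Ω} [mΩ : MeasurableSpace Ω] {P : Measure Ω} 
  {r : ℝ≥0} {N : ℝ≥0 → Ω → ℕ}

lemma IsPoissonProcess.lintegral_increment (hN : IsPoissonProcess P r N) (s h : ℝ≥0) :
    ∫⁻ ω, ((N (s + h) ω - N s ω : ℕ) : ENNReal) ∂P = r * h := by
  have hl := (hN.law_increment s h)
  have hm : Measurable fun n : ℕ => (n : ENNReal) := measurable_from_top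
  have := lintegral_map (μ := P) hm ((hN.measurable (s + h)).sub (hN.measurable s))
  rw [show (fun ω => N (s + h) ω - N s ω) = N (s + h) - N s from rfl] at hl
  rw [hl.map_eq, lintegral_id_poissonMeasure] at this
  simpa using this.symm

lemma IsPoissonProcess.indep_increment_finset [IsProbabilityMeasure P]
    (hN : IsPoissonProcess P r N) (t h : ℝ≥0)
    (s : Finset (Set.Iic t)) :
    Indep (⨆ u ∈ s, MeasurableSpace.comap (N u) inferInstance)
      (MeasurableSpace.comap (fun ω => N (t + h) ω - N t ω) inferInstance) P := by
  classical
  let e := s.orderEmbOfFin rfl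
  -- The sequence `τ` runs through 0, the elements of `s` in increasing order, then `t`, and is
  -- constantly `t + h` afterwards. Hence increment number `s.card + 1` is the one over `(t, t +
  -- h]`, and the earlier ones determine all `N u` with `u ∈ s`.
  let τ : ℕ → ℝ≥0 := fun l => if l = 0 then 0 else if hl : l - 1 < s.card then e ⟨l - 1, hl⟩ else
    if l = s.card + 1 then t else t + h
  have hτ0 : τ 0 = 0 := by simp [τ]
  have hτs : ∀ l : Fin s.card, τ (l + 1) = e l := fun l => by simp [τ]
  have hτt : τ (s.card + 1) = t := by simp [τ]
  have hτh : τ (s.card + 2) = t + h := by simp [τ]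
  have hmono : Monotone τ := by
    refine monotone_nat_of_le_succ fun l => ?_
    rcases Nat.eq_zero_or_pos l with rfl | hl
    · rw [hτ0]; exact zero_le
    · obtain ⟨l, rfl⟩ : ∃ k, l = k + 1 := ⟨l - 1, by omega⟩
      rcases lt_trichotomy (l + 1) s.card with h1 | h1 | h1
      · rw [hτs ⟨l, by omega⟩, hτs ⟨l + 1, h1⟩]
        exact e.monotone (Nat.le_succ l)
      · rw [hτs ⟨l, by omega⟩, show l + 1 + 1 = s.card + 1 by omega, hτt]
        exact (e _).2
      · by_cases h2 : l = s.card
        · subst h2; rw [hτt, hτh]; exact le_self_add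
        · have h3 : ∀ k, s.card + 2 ≤ k → τ k = t + h := fun k hk => by
            have : ¬ k = 0 := by omega
            have h' : ¬ k - 1 < s.card := by omega
            have h'' : ¬ k = s.card + 1 := by omega
            simp [τ, this, h', h'']
          rw [h3 _ (by omega), h3 _ (by omega)]
  have hind := hN.indep_increments.nat hmono
  have hmeas : ∀ i, Measurable fun ω => N (τ (i + 1)) ω - N (τ i) ω :=
    fun i => (hN.measurable _).sub (hN.measurable _)
  have h1 := hind.indepFun_finset (Finset.range (s.card + 1)) {s.card + 1} (by simp) hmeas
  have h2 : Measurable[MeasurableSpace.comap (fun ω (i : Finset.range (s.card + 1)) =>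
      N (τ (i + 1)) ω - N (τ i) ω) inferInstance]
      (fun ω (i : Finset.range (s.card + 1)) => N (τ (i + 1)) ω - N (τ i) ω) :=
    comap_measurable _
  refine indep_of_indep_of_le h1 ?_ ?_
  · refine iSup₂_le fun u hu => ?_
    rw [← measurable_iff_comap_le]
    obtain ⟨l, hl⟩ : ∃ l, e l = u := by
      have : u ∈ Set.range e := by rw [Finset.range_orderEmbOfFin]; exact hu
      exact this
    have hsum : N u = fun ω => ∑ k ∈ Finset.range (l + 1 : ℕ), (N (τ (k + 1)) ω - N (τ k) ω) := by
      funext ω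
      rw [Finset.sum_range_tsub (f := fun k => N (τ k) ω) fun a b hab => hN.mono ω (hmono hab),
        hτ0, hN.zero, hτs, hl, Nat.sub_zero]
    rw [hsum]
    refine Finset.measurable_sum _ fun k hk => ?_
    have hk' : k < s.card + 1 := by
      have := Finset.mem_range.1 hk
      omega
    exact (measurable_pi_apply (⟨k, Finset.mem_range.2 hk'⟩ : Finset.range (s.card + 1))).comp h2
  · have h3 := comap_measurable (m := inferInstance) (fun ω (i : ({s.card + 1} : Finset ℕ)) =>
      N (τ (i + 1)) ω - N (τ i) ω)
    have h4 := (measurable_pi_apply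
      (⟨s.card + 1, Finset.mem_singleton_self _⟩ : ({s.card + 1} : Finset ℕ))).comp h3
    rw [← measurable_iff_comap_le]
    convert! h4 using 1
    funext ω
    simp only [Function.comp, hτt]
    rw [show s.card + 1 + 1 = s.card + 2 from rfl, hτh]

/-- The σ-algebra generated by a process up to time `t`. -/
abbrev past (N : ℝ≥0 → Ω → ℕ) (t : ℝ≥0) : MeasurableSpace Ω :=
  ⨆ u : Set.Iic t, MeasurableSpace.comap (N u) inferInstance

lemma IsPoissonProcess.past_le (hN : IsPoissonProcess P r N) (t : ℝ≥0) : past N t ≤ mΩ :=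
  iSup_le fun u => (hN.measurable u).comap_le

/-- The finite sets of times up to `t` are directed, and their σ-algebras generate the past, so the
finite case suffices. -/
lemma IsPoissonProcess.indep_increment_past [IsProbabilityMeasure P] (hN : IsPoissonProcess P r N) (t h : ℝ≥0) :
    Indep (MeasurableSpace.comap (fun ω => N (t + h) ω - N t ω) inferInstance) (past N t) P := by
  have h1 := indep_iSup_of_directed_le (hN.indep_increment_finset t h)
    (fun s => iSup₂_le fun u _ => (hN.measurable u).comap_le)
    ((hN.measurable _).sub (hN.measurable _)).comap_le
    (directed_of_isDirected_le fun s s' hs => biSup_mono fun u hu => Finset.mem_of_subset hs hu)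
  refine (indep_of_indep_of_le_left h1 (iSup_le fun u => ?_)).symm
  exact le_iSup_of_le {u} (le_iSup₂_of_le u (Finset.mem_singleton_self u) le_rfl)

/-- The number of arrivals up to a stopping time `T` has mean `r * 𝔼 T`. Here `T` may use
information that is independent of the arrival process. -/
lemma IsPoissonProcess.lintegral_stopping [IsProbabilityMeasure P] (hN : IsPoissonProcess P r N)
    (h𝓞 : 𝓞 ≤ mΩ)
    (hind : Indep (⨆ u, MeasurableSpace.comap (N u) inferInstance) 𝓞 P) {T : Ω → ℝ≥0}
    (hT : Measurable T) (hfin : ∫⁻ ω, (T ω : ENNReal) ∂P ≠ ⊤)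
    (hadapted : ∀ t, ∃ E, MeasurableSet[past N t ⊔ 𝓞] E ∧ ∀ᵐ ω ∂P, T ω ≤ t ↔ ω ∈ E) :
    ∫⁻ ω, (N (T ω) ω : ENNReal) ∂P = r * ∫⁻ ω, (T ω : ENNReal) ∂P := by
  -- `T` is rounded up to the grid of mesh `1 / (n + 1)`. Wald's identity applies to the increments
  -- over the grid cells, and right-continuity removes the discretisation.
  let K : ℕ → Ω → ℕ := fun n ω => ⌈(n + 1 : ℝ≥0) * T ω⌉₊
  let S : ℕ → Ω → ℝ≥0 := fun n ω => K n ω / (n + 1)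
  have hpos : ∀ n : ℕ, (0 : ℝ≥0) < n + 1 := fun n => by positivity
  have hle : ∀ n ω, T ω ≤ S n ω := fun n ω => by
    rw [le_div_iff₀ (hpos n), mul_comm]; exact Nat.le_ceil _
  have hub : ∀ n ω, S n ω ≤ T ω + 1 / (n + 1) := fun n ω => by
    rw [div_le_iff₀ (hpos n), add_mul, div_mul_cancel₀ _ (hpos n).ne', mul_comm (T ω)]
    exact (Nat.ceil_lt_add_one zero_le).le
  -- Each grid contains the integers, so rounding up to integers dominates all other roundings. This
  -- provides the majorant for the limit `n → ∞`.
  have hS0 : ∀ n ω, S n ω ≤ S 0 ω := fun n ω => by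
    have h1 : K n ω ≤ (n + 1) * K 0 ω := by
      refine Nat.ceil_le.2 ?_
      push_cast
      gcongr
      simpa [K] using Nat.le_ceil (T ω)
    rw [div_le_iff₀ (hpos n)]
    simp only [S, Nat.cast_zero, zero_add, div_one]
    rw [mul_comm]
    exact_mod_cast h1
  have hK : ∀ n, Measurable (K n) := fun n => Nat.measurable_ceil.comp (hT.const_mul _)
  have hS : ∀ n, Measurable (S n) := fun n =>
    ((measurable_from_top (f := fun k : ℕ => (k : ℝ≥0))).comp (hK n)).div_const _
  have hNT : ∀ {U : Ω → ℝ≥0}, Measurable U → Measurable fun ω => (N (U ω) ω : ENNReal) :=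
    fun hU => (measurable_from_top (f := fun k : ℕ => (k : ENNReal))).comp (hN.measurable_comp hU)
  have hmean : ∀ n, ∫⁻ ω, (N (S n ω) ω : ENNReal) ∂P = r * ∫⁻ ω, (S n ω : ENNReal) ∂P := by
    intro n
    let X : ℕ → Ω → ENNReal := fun k ω =>
      ((N (k / (n + 1) + 1 / (n + 1)) ω - N (k / (n + 1)) ω : ℕ) : ENNReal)
    have hXm : ∀ k, Measurable (X k) := fun k =>
      (measurable_from_top (f := fun k : ℕ => (k : ENNReal))).comp
        ((hN.measurable _).sub (hN.measurable _))
    have hw := wald (hK n) hXm (β := r * ((1 / (n + 1) : ℝ≥0) : ENNReal))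
      (fun k => hN.lintegral_increment _ _) ?_
    · have h1 : ∀ ω, (N (S n ω) ω : ENNReal) = ∑ k ∈ Finset.range (K n ω), X k ω := by
        intro ω
        have h2 : ∀ k : ℕ, (k : ℝ≥0) / (n + 1) + 1 / (n + 1) = ((k + 1 : ℕ) : ℝ≥0) / (n + 1) :=
          fun k => by push_cast; rw [add_div]
        simp only [X, h2]
        rw [← Nat.cast_sum, Finset.sum_range_tsub (f := fun k : ℕ => N ((k : ℝ≥0) / (n + 1)) ω)
          fun a b hab => hN.mono ω (by gcongr)]
        simp [hN.zero, S]
      simp_rw [h1]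
      rw [hw, mul_assoc, ← lintegral_const_mul]
      · congr 1
        refine lintegral_congr fun ω => ?_
        rw [← ENNReal.coe_natCast, ← ENNReal.coe_mul]
        congr 1
        simp only [S]
        rw [div_mul_eq_mul_div, one_mul]
      · exact (measurable_from_top (f := fun k : ℕ => (k : ENNReal))).comp (hK n)
    · intro k
      refine ⟨past N (k / (n + 1)) ⊔ 𝓞, sup_le (hN.past_le _) h𝓞, ?_, ?_⟩
      · have h1 : MeasurableSpace.comap (X k) inferInstance ≤ MeasurableSpace.comap (fun ω =>
            N (k / (n + 1) + 1 / (n + 1)) ω - N (k / (n + 1)) ω) inferInstance := by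
          rw [← measurable_iff_comap_le]
          exact (measurable_from_top (f := fun k : ℕ => (k : ENNReal))).comp (comap_measurable _)
        refine indep_of_indep_of_le_left ?_ h1
        refine Indep.sup_right ((hN.measurable _).sub (hN.measurable _)).comap_le (hN.past_le _) h𝓞
          (hN.indep_increment_past _ _) (indep_of_indep_of_le_left hind (sup_le ?_ ?_))
        · rw [← measurable_iff_comap_le]
          have hu : ∀ u, Measurable[⨆ u, MeasurableSpace.comap (N u) inferInstance] (N u) :=
            fun u => measurable_iff_comap_le.2 (le_iSup (fun u => MeasurableSpace.comap (N u)
              inferInstance) u)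
          exact (hu _).sub (hu _)
        · exact iSup_le fun u => le_iSup (fun u => MeasurableSpace.comap (N u) inferInstance) u.1
      · obtain ⟨E, hE, hTE⟩ := hadapted (k / (n + 1))
        refine ⟨E, hE, ?_⟩
        filter_upwards [hTE] with ω hω
        rw [← hω, le_div_iff₀ (hpos n), mul_comm]
        -- Because of rounding up, `K n ≤ k` means `T ≤ k / (n + 1)`, which is known before
        -- increment `k` begins.
        exact Nat.ceil_le
  have hSint : ∀ n, ∫⁻ ω, (S n ω : ENNReal) ∂P
      ≤ ∫⁻ ω, (T ω : ENNReal) ∂P + ((1 / (n + 1) : ℝ≥0) : ENNReal) := fun n => by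
    calc ∫⁻ ω, (S n ω : ENNReal) ∂P
        ≤ ∫⁻ ω, ((T ω : ENNReal) + ((1 / (n + 1) : ℝ≥0) : ENNReal)) ∂P :=
          lintegral_mono fun ω => by
            rw [← ENNReal.coe_add]; exact ENNReal.coe_le_coe.2 (hub n ω)
      _ = _ := by
          rw [lintegral_add_right _ measurable_const]; simp
  have h0 : Filter.Tendsto (fun n : ℕ => (1 : ℝ≥0) / (n + 1)) Filter.atTop (nhds 0) :=
    tendsto_one_div_add_atTop_nhds_zero_nat
  have hlimS : Filter.Tendsto (fun n => ∫⁻ ω, (S n ω : ENNReal) ∂P) Filter.atTop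
      (nhds (∫⁻ ω, (T ω : ENNReal) ∂P)) := by
    refine tendsto_of_tendsto_of_tendsto_of_le_of_le tendsto_const_nhds ?_
      (fun n => lintegral_mono fun ω => ENNReal.coe_le_coe.2 (hle n ω)) hSint
    have := (ENNReal.tendsto_coe.2 h0).const_add (∫⁻ ω, (T ω : ENNReal) ∂P)
    simpa using this
  have hlimN : Filter.Tendsto (fun n => ∫⁻ ω, (N (S n ω) ω : ENNReal) ∂P) Filter.atTop
      (nhds (∫⁻ ω, (N (T ω) ω : ENNReal) ∂P)) := by
    refine tendsto_lintegral_of_dominated_convergence (fun ω => (N (S 0 ω) ω : ENNReal))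
      (fun n => hNT (hS n)) (fun n => ae_of_all _ fun ω => ?_) ?_ (ae_of_all _ fun ω => ?_)
    · exact Nat.cast_le.2 (hN.mono ω (hS0 n ω))
    · rw [hmean]
      refine ENNReal.mul_ne_top ENNReal.coe_ne_top (ne_top_of_le_ne_top ?_ (hSint 0))
      exact ENNReal.add_ne_top.2 ⟨hfin, ENNReal.coe_ne_top⟩
    · have hlim : Filter.Tendsto (fun n => S n ω) Filter.atTop (nhds (T ω)) := by
        refine tendsto_of_tendsto_of_tendsto_of_le_of_le tendsto_const_nhds ?_
          (fun n => hle n ω) (fun n => hub n ω)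
        simpa using h0.const_add (T ω)
      have h1 := (hN.right_cont ω (T ω)).tendsto.comp
        (tendsto_nhdsWithin_iff.2 ⟨hlim, Filter.Eventually.of_forall fun n => hle n ω⟩)
      exact ((continuous_of_discreteTopology (f := fun k : ℕ => (k : ENNReal))).tendsto _).comp h1
  refine tendsto_nhds_unique hlimN ?_
  simp_rw [hmean]
  exact ENNReal.Tendsto.const_mul hlimS (Or.inr ENNReal.coe_ne_top)

end Poisson


/-! ### Pathwise monotonicity and locality of the dynamics. -/

section Paths

variable {I : ℕ} {a a' : Fin I → ℝ≥0 → ℕ} {b b' : Fin I → ℕ → ℝ≥0} {c : Fin I → ℕ}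

lemma le_phase (i : Fin I) (s : State I) : s ≤ phase a b c i s := by
  refine ⟨le_self_add, fun j => ?_⟩
  by_cases h : j = i
  · subst h; simp [phase]
  · simp [phase, h]

lemma iterate_phase_mono (i : Fin I) (s : State I) :
    Monotone fun k => (phase a b c i)^[k] s :=
  monotone_nat_of_le_succ fun k => by
    rw [Function.iterate_succ_apply']; exact le_phase i _

lemma queue_congr {s : State I} (h : ∀ j, a' j s.1 = a j s.1) : queue a' c s = queue a c s := by
  funext j; simp [queue, h]

/-- The number served is fixed at the gating instant and involves no service times. Hence the range
of services in `phase_congr` may be read off from either of the two dynamics. -/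
lemma phase_snd_congr {i : Fin I} {s : State I} (h : ∀ j, a' j s.1 = a j s.1) :
    (phase a' b' c i s).2 = (phase a b c i s).2 := by
  simp [phase, queue_congr h]

lemma phase_congr {i : Fin I} {s : State I} (h : ∀ j, a' j s.1 = a j s.1)
    (hb : ∀ k < (phase a b c i s).2 i, b' i k = b i k) : phase a' b' c i s = phase a b c i s := by
  refine Prod.ext ?_ (phase_snd_congr h)
  simp only [phase, queue_congr h]
  congr 1
  refine Finset.sum_congr rfl fun k hk => hb _ ?_
  have := Finset.mem_range.1 hk
  simp only [phase, Function.update_self]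
  omega

/-- By `hne` the infimum defining the waiting time is attained, so it is determined by the arrivals
up to and including that time. This also excludes the default value of `sInf ∅`. -/
lemma wait_congr (h : ∀ u ≤ (wait a c 0).1, ∀ j, a' j u = a j u)
    (hne : queue a c (wait a c 0) ≠ 0) : wait a' c 0 = wait a c 0 := by
  have h0 : queue a' c 0 = queue a c 0 := queue_congr (h 0 zero_le)
  by_cases hq : queue a c 0 = 0
  · have hq' : queue a' c 0 = 0 := h0.trans hq
    simp only [wait, hq, hq', if_true] at h hne ⊢
    set A := {u : ℝ≥0 | (0 : State I).1 ≤ u ∧ queue a c (u, (0 : State I).2) ≠ 0}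
    refine Prod.ext ?_ rfl
    refine IsLeast.csInf_eq ⟨⟨zero_le, ?_⟩, ?_⟩
    · rwa [queue_congr (a := a) (h _ le_rfl)]
    · rintro u ⟨hu0, hu⟩
      by_contra! hlt
      rw [queue_congr (a := a) (h _ hlt.le)] at hu
      exact absurd (csInf_le (OrderBot.bddBelow A) ⟨hu0, hu⟩) (not_le.2 hlt)
  · have hq' : queue a' c 0 ≠ 0 := fun h' => hq (h0.symm.trans h')
    simp only [wait, hq, hq', if_false]

end Paths

/-! ### Measurability with respect to an arbitrary σ-algebra -/

/-- A counting process with nondecreasing right-continuous paths. -/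
structure IsCounting {Ω : Type*} [MeasurableSpace Ω] (N : ℝ≥0 → Ω → ℕ) : Prop where
  measurable : ∀ t, Measurable (N t)
  mono : ∀ ω, Monotone (fun t => N t ω)
  right_cont : ∀ ω t, ContinuousWithinAt (fun u => N u ω) (Set.Ici t) t

lemma IsPoissonProcess.isCounting {Ω : Type*} [MeasurableSpace Ω] {P : Measure Ω} {r : ℝ≥0}
    {N : ℝ≥0 → Ω → ℕ} (hN : IsPoissonProcess P r N) : IsCounting N :=
  ⟨hN.measurable, hN.mono, hN.right_cont⟩

section Measurability

variable {I : ℕ} {Ω : Type*} [MeasurableSpace Ω]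

/-- `T` is approximated from the right by times with countably many values, and right-continuity
passes to the limit. No law is involved, so this applies to any σ-algebra for which the process is
measurable. -/
lemma IsCounting.measurable_comp {N : ℝ≥0 → Ω → ℕ}
    (hN : IsCounting N) {T : Ω → ℝ≥0} (hT : Measurable T) :
    Measurable fun ω => N (T ω) ω := by
  let S : ℕ → Ω → ℝ≥0 := fun n ω => ((⌊(n + 1 : ℝ≥0) * T ω⌋₊ : ℝ≥0) + 1) / (n + 1)
  have hS : ∀ n, Measurable fun ω => N (S n ω) ω := fun n =>
    measurable_natComp (f := fun k ω => N (((k : ℝ≥0) + 1) / (n + 1)) ω)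
      (fun k => hN.measurable _) (Nat.measurable_floor.comp (hT.const_mul _))
  refine measurable_of_tendsto_metrizable hS (tendsto_pi_nhds.2 fun ω => ?_)
  have hle : ∀ n, T ω ≤ S n ω := fun n => by
    have h0 : (0 : ℝ≥0) < n + 1 := by positivity
    rw [le_div_iff₀ h0, mul_comm]
    exact (Nat.lt_floor_add_one _).le
  have hub : ∀ n, S n ω ≤ T ω + 1 / (n + 1) := fun n => by
    have h0 : (0 : ℝ≥0) < n + 1 := by positivity
    have h1 : (T ω + 1 / (n + 1)) * (n + 1) = (n + 1) * T ω + 1 := by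
      rw [add_mul, div_mul_cancel₀ _ h0.ne', mul_comm]
    rw [div_le_iff₀ h0, h1]
    gcongr
    exact Nat.floor_le (by positivity)
  have hlim : Filter.Tendsto (fun n => S n ω) Filter.atTop (nhds (T ω)) := by
    refine tendsto_of_tendsto_of_tendsto_of_le_of_le tendsto_const_nhds ?_ hle hub
    have h1 : Filter.Tendsto (fun n : ℕ => (1 : ℝ≥0) / (n + 1)) Filter.atTop (nhds 0) :=
      tendsto_one_div_add_atTop_nhds_zero_nat
    simpa using tendsto_const_nhds.add h1
  exact (hN.right_cont ω (T ω)).tendsto.comp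
    (tendsto_nhdsWithin_iff.2 ⟨hlim, Filter.Eventually.of_forall hle⟩)

variable {a : Fin I → ℝ≥0 → Ω → ℕ} {b : Fin I → ℕ → Ω → ℝ≥0} (c : Fin I → ℕ)

lemma measurable_queue_of_isCounting (ha : ∀ i, IsCounting (a i)) {s : Ω → State I}
    (hs : Measurable s) : Measurable fun ω => queue (fun i t => a i t ω) c (s ω) := by
  refine measurable_pi_iff.2 fun j => ?_
  have h1 := (ha j).measurable_comp hs.fst
  have h2 : Measurable fun ω => (s ω).2 j := (measurable_pi_apply j).comp hs.snd
  exact ((measurable_const.add h1).sub h2 :)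

lemma measurable_phase_of_isCounting (ha : ∀ i, IsCounting (a i)) (hb : ∀ i k, Measurable (b i k))
    (i : Fin I) {s : Ω → State I} (hs : Measurable s) :
    Measurable fun ω => phase (fun i t => a i t ω) (fun i k => b i k ω) c i (s ω) := by
  have hq := (measurable_pi_iff.1 (measurable_queue_of_isCounting c ha hs)) i
  have hd : Measurable fun ω => (s ω).2 i := (measurable_pi_apply i).comp hs.snd
  refine Measurable.prodMk (hs.fst.add ?_) ?_
  · refine measurable_natComp
      (f := fun n ω => ∑ k ∈ Finset.range n, b i ((s ω).2 i + k) ω) (fun n => ?_) hq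
    refine Finset.measurable_sum _ fun k _ => ?_
    exact measurable_natComp (f := fun d ω => b i (d + k) ω) (fun d => hb i _) hd
  · refine measurable_pi_iff.2 fun j => ?_
    by_cases h : j = i
    · subst h
      simp only [Function.update_self]
      exact hd.add hq
    · simp only [Function.update_of_ne h]
      exact (measurable_pi_apply j).comp hs.snd

lemma measurable_wait_of_isCounting (ha : ∀ i, IsCounting (a i)) {s : Ω → State I}
    (hs : Measurable s) : Measurable fun ω => wait (fun i t => a i t ω) c (s ω) := by
  refine Measurable.ite (measurable_queue_of_isCounting c ha hs (measurableSet_singleton 0)) ?_ hs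
  refine Measurable.prodMk (measurable_of_Iio fun r => ?_) hs.snd
  let S : Ω → Set ℝ≥0 := fun ω =>
    {u | (s ω).1 ≤ u ∧ queue (fun i t => a i t ω) c (u, (s ω).2) ≠ 0}
  have hS : ∀ u, MeasurableSet {ω | u ∈ S ω} := fun u =>
    (measurableSet_le hs.fst measurable_const).inter
      (measurable_queue_of_isCounting c ha (measurable_const.prodMk hs.snd)
        (measurableSet_singleton 0).compl)
  -- Since `S ω` is upward closed, whether it has a point below `r` can be tested on rationals.
  have hup : ∀ ω u v, u ∈ S ω → u ≤ v → v ∈ S ω := by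
    rintro ω u v ⟨h1, h2⟩ huv
    refine ⟨h1.trans huv, fun h => h2 (funext fun j => ?_)⟩
    have h3 := congrFun h j
    have h4 := (ha j).mono ω huv
    simp only [queue, Pi.zero_apply] at h3 h4 ⊢
    omega
  have hrat : ∀ ω (r : ℝ≥0), (∃ u ∈ S ω, u < r) ↔
      ∃ z : ℚ, Real.toNNReal z < r ∧ Real.toNNReal z ∈ S ω := by
    refine fun ω r => ⟨?_, fun ⟨z, h1, h2⟩ => ⟨_, h2, h1⟩⟩
    rintro ⟨u, hu, hur⟩
    obtain ⟨z, -, h1, h2⟩ := (NNReal.lt_iff_exists_rat_btwn u r).1 hur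
    exact ⟨z, h2, hup ω u _ hu h1.le⟩
  have hex : ∀ r : ℝ≥0, MeasurableSet {ω | ∃ u ∈ S ω, u < r} := by
    intro r
    simp only [hrat, Set.ofPred_exists]
    exact MeasurableSet.iUnion fun z => (MeasurableSet.const _).inter (hS _)
  have hne : MeasurableSet {ω | (S ω).Nonempty} := by
    have : {ω | (S ω).Nonempty} = ⋃ n : ℕ, {ω | ∃ u ∈ S ω, u < (n : ℝ≥0)} := by
      ext ω
      simp only [Set.mem_ofPred_eq, Set.mem_iUnion]
      constructor
      · rintro ⟨u, hu⟩
        obtain ⟨n, hn⟩ := exists_nat_gt u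
        exact ⟨n, u, hu, hn⟩
      · rintro ⟨n, u, hu, -⟩
        exact ⟨u, hu⟩
    rw [this]
    exact MeasurableSet.iUnion fun n => hex n
  -- The second set accounts for `sInf ∅ = 0` in `ℝ≥0`.
  have : (fun ω => sInf (S ω)) ⁻¹' Set.Iio r =
      {ω | ∃ u ∈ S ω, u < r} ∪ ({ω | (S ω).Nonempty}ᶜ ∩ {_ω | 0 < r}) := by
    ext ω
    by_cases h : (S ω).Nonempty
    · simp [h, csInf_lt_iff (OrderBot.bddBelow _) h]
    · rw [Set.not_nonempty_iff_eq_empty] at h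
      simp [h]
  change MeasurableSet ((fun ω => sInf (S ω)) ⁻¹' Set.Iio r)
  rw [this]
  exact (hex r).union (hne.compl.inter (MeasurableSet.const _))

end Measurability

/-! ### Partial observations of the model -/

section Observations

variable {I : ℕ} {Ω : Type*} [mΩ : MeasurableSpace Ω] {P : Measure Ω}

/-- A σ-algebra `info`, together with modified arrival processes and service times that are
measurable with respect to it and agree with those of the model as long as the state of the system
remains in `region`. -/
structure Observation (m : PollingModel I P) where
  arr : Fin I → ℝ≥0 → Ω → ℕ
  srv : Fin I → ℕ → Ω → ℝ≥0
  region : Set (State I)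
  measurableSet_region : MeasurableSet region
  isLowerSet_region : IsLowerSet region
  arr_eq : ∀ s ∈ region, ∀ i ω, arr i s.1 ω = m.arr i s.1 ω
  srv_eq : ∀ s ∈ region, ∀ i, ∀ k < s.2 i, ∀ ω, srv i k ω = m.srv i k ω
  info : MeasurableSpace Ω
  isCounting : ∀ i, @IsCounting Ω info (arr i)
  measurable_srv : ∀ i k, Measurable[info] (srv i k)

variable {m : PollingModel I P}

/-- The observation determines whether the random state `S` is in the region, and the value of `S`
if it is. -/
def Observation.Observes (O : Observation m) (S : Ω → State I) : Prop :=
  ∃ (U : Ω → State I) (E : Set Ω), Measurable[O.info] U ∧ MeasurableSet[O.info] E ∧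
    ∀ᵐ ω ∂P, (S ω ∈ O.region ↔ ω ∈ E) ∧ (ω ∈ E → S ω = U ω)

namespace PollingModel

variable (m) (c : Fin I → ℕ)

/-- The queue lengths in the state `s`, for the outcome `ω`. -/
noncomputable abbrev queueIn (ω : Ω) (s : State I) : Fin I → ℕ :=
  queue (fun i t => m.arr i t ω) c s

/-- The state after a gated phase that starts in the state `s`, for the outcome `ω`. -/
noncomputable abbrev phaseFrom (i : Fin I) (ω : Ω) (s : State I) : State I :=
  phase (fun i t => m.arr i t ω) (fun i k => m.srv i k ω) c i s

/-- The state after a visit of the first session that starts in the state `s`, for the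
outcome `ω`. -/
noncomputable abbrev visitFrom (i : Fin I) (ω : Ω) (s : State I) : State I :=
  visit (fun i t => m.arr i t ω) (fun i k => m.srv i k ω) c (m.gate i 0 ω) i s

end PollingModel

variable {c : Fin I → ℕ}

/-- States only increase and the region is a lower set, so ending a phase inside it forces starting
inside it. There the modified primitives agree with the true ones, and the modified phase,
measurable for `info`, serves as witness. -/
lemma Observation.Observes.phase {O : Observation m} {S : Ω → State I} (hS : O.Observes S)
    (i : Fin I) : O.Observes fun ω => m.phaseFrom c i ω (S ω) := by
  obtain ⟨U, E, hU, hE, h⟩ := hS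
  have hU' := @measurable_phase_of_isCounting I Ω O.info O.arr O.srv c O.isCounting
    O.measurable_srv i U hU
  refine ⟨_, E ∩ _, hU', hE.inter (hU' O.measurableSet_region), ?_⟩
  filter_upwards [h] with ω ⟨h1, h2⟩
  -- The two dynamics agree as soon as either of the resulting states lies in the region; each
  -- direction of the equivalence below needs one of these cases.
  have key : S ω ∈ O.region → S ω = U ω →
      (m.phaseFrom c i ω (S ω) ∈ O.region ∨
        Polling.phase (fun i t => O.arr i t ω) (fun i k => O.srv i k ω) c i (U ω) ∈ O.region) →
      Polling.phase (fun i t => O.arr i t ω) (fun i k => O.srv i k ω) c i (U ω) =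
        m.phaseFrom c i ω (S ω) := by
    intro hR hSU hor
    rw [← hSU] at hor ⊢
    have ha : ∀ j, O.arr j (S ω).1 ω = m.arr j (S ω).1 ω := fun j => O.arr_eq _ hR j ω
    refine phase_congr ha fun k hk => ?_
    rcases hor with hor | hor
    · exact O.srv_eq _ hor i k hk ω
    · refine O.srv_eq _ hor i k ?_ ω
      rwa [phase_snd_congr (a := fun i t => m.arr i t ω) (b := fun i k => m.srv i k ω) ha]
  refine ⟨⟨fun hp => ?_, ?_⟩, ?_⟩
  · have hR := O.isLowerSet_region (le_phase i (S ω)) hp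
    have hω := h1.1 hR
    have hk := key hR (h2 hω) (Or.inl hp)
    refine ⟨hω, ?_⟩
    rw [Set.mem_preimage, hk]
    exact hp
  · rintro ⟨hω, hp⟩
    rw [← key (h1.2 hω) (h2 hω) (Or.inr hp)]
    exact hp
  · rintro ⟨hω, hp⟩
    exact (key (h1.2 hω) (h2 hω) (Or.inr hp)).symm

lemma Observation.Observes.iterate_phase {O : Observation m} {S : Ω → State I}
    (hS : O.Observes S) (i : Fin I) (k : ℕ) :
    O.Observes fun ω => (m.phaseFrom c i ω)^[k] (S ω) := by
  induction k with
  | zero => exact hS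
  | succ k ih =>
    simp only [Function.iterate_succ_apply']
    exact ih.phase i

/-- If the visit ends inside the region, all earlier phases did too, so the modified dynamics
satisfy the same stopping criterion at the same phase. The hypothesis `hend` excludes endless
visits, for which `phaseCount` is a default value. -/
lemma Observation.Observes.visit {O : Observation m} {S : Ω → State I}
    (hS : O.Observes S) (i : Fin I) (hg : Measurable[O.info] (m.gate i 0))
    (hend : ∀ᵐ ω ∂P, ∃ k : ℕ, (k : ℕ∞) = m.gate i 0 ω ∨
      m.queueIn c ω ((m.phaseFrom c i ω)^[k] (S ω)) i = 0) :
    O.Observes fun ω => m.visitFrom c i ω (S ω) := by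
  have hk := fun k => hS.iterate_phase (c := c) i k
  choose U E hU hE h using hk
  let p : ℕ → Ω → Prop := fun k ω => (k : ℕ∞) = m.gate i 0 ω ∨
    queue (fun i t => O.arr i t ω) c (U k ω) i = 0
  have hp : ∀ k, MeasurableSet[O.info] {ω | p k ω} := fun k => by
    refine @MeasurableSet.union Ω O.info _ _ ?_ ?_
    · exact hg (MeasurableSet.of_discrete (s := {g | (k : ℕ∞) = g}))
    · exact ((measurable_pi_apply i).comp (@measurable_queue_of_isCounting I Ω O.info O.arr c
        O.isCounting (U k) (hU k))) (measurableSet_singleton 0)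
  have hN := @measurable_natSInf Ω O.info p hp
  refine ⟨fun ω => U (sInf {k | p k ω}) ω, {ω | ∃ k, p k ω ∧ ∀ j ≤ k, ω ∈ E j},
    @measurable_natComp Ω O.info _ _ _ hU _ hN, ?_, ?_⟩
  · have : {ω | ∃ k, p k ω ∧ ∀ j ≤ k, ω ∈ E j} =
        ⋃ k, {ω | p k ω} ∩ ⋂ j, ⋂ _ : j ≤ k, E j := by
      ext ω; simp
    rw [this]
    exact MeasurableSet.iUnion fun k => (hp k).inter
      (MeasurableSet.iInter fun j => MeasurableSet.iInter fun _ => hE j)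
  filter_upwards [ae_all_iff.2 h, hend] with ω hω hex
  set F : ℕ → State I := fun k => (m.phaseFrom c i ω)^[k] (S ω)
  set q : ℕ → Prop := fun k => (k : ℕ∞) = m.gate i 0 ω ∨ m.queueIn c ω (F k) i = 0
  have hqp : ∀ k, ω ∈ E k → (q k ↔ p k ω) := fun k hk => by
    have h1 := (hω k).2 hk
    have h2 := (hω k).1.2 hk
    have : m.queueIn c ω (F k) = queue (fun i t => O.arr i t ω) c (U k ω) := by
      rw [← h1]
      exact (queue_congr fun j => O.arr_eq _ h2 j ω).symm
    simp only [p, q, this]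
  have hv : m.visitFrom c i ω (S ω) = F (sInf {k | q k}) := rfl
  set n := sInf {k | q k}
  have hqn : q n := Nat.sInf_mem hex
  rw [hv]
  refine ⟨⟨fun hR => ?_, ?_⟩, ?_⟩
  · have hj : ∀ j ≤ n, ω ∈ E j := fun j hj =>
      (hω j).1.1 (O.isLowerSet_region (iterate_phase_mono i (S ω) hj) hR)
    exact ⟨n, (hqp n (hj n le_rfl)).1 hqn, hj⟩
  · rintro ⟨k, hk, hj⟩
    have hnk : n ≤ k := Nat.sInf_le ((hqp k (hj k le_rfl)).2 hk)
    exact (hω n).1.2 (hj n hnk)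
  · rintro ⟨k, hk, hj⟩
    have hnk : n ≤ k := Nat.sInf_le ((hqp k (hj k le_rfl)).2 hk)
    have hpn : p n ω := (hqp n (hj n hnk)).1 hqn
    have h1 : sInf {k | p k ω} ≤ n := Nat.sInf_le hpn
    have h2 : p (sInf {k | p k ω}) ω := Nat.sInf_mem (s := {k | p k ω}) ⟨n, hpn⟩
    have h3 : n ≤ sInf {k | p k ω} := Nat.sInf_le ((hqp _ (hj _ (h1.trans hnk))).2 h2)
    change F n = U (sInf {k | p k ω}) ω
    rw [le_antisymm h1 h3]
    exact (hω n).2 (hj n hnk)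

/-- No departures occur while waiting, so a waiting state in the region puts all earlier times in
the region as well, and `wait_congr` applies. Both the true and the modified wait must end with a
nonempty system, whence the second condition in the observed event. -/
lemma Observation.observes_wait (O : Observation m)
    (hne : ∀ᵐ ω ∂P, m.queueIn c ω (wait (fun i t => m.arr i t ω) c 0) ≠ 0) :
    O.Observes fun ω => wait (fun i t => m.arr i t ω) c 0 := by
  have hU := @measurable_wait_of_isCounting I Ω O.info O.arr c O.isCounting (fun _ => 0)
    measurable_const
  have hQ := @measurable_queue_of_isCounting I Ω O.info O.arr c O.isCounting _ hU
  have hsnd : ∀ a : Fin I → ℝ≥0 → ℕ, (wait a c 0).2 = 0 := fun a => by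
    unfold wait; split_ifs <;> rfl
  have hagree : ∀ ω (s : State I), s ∈ O.region → s.2 = 0 → ∀ u ≤ s.1, ∀ j,
      O.arr j u ω = m.arr j u ω := fun ω s hs h0 u hu j =>
    O.arr_eq (u, 0) (O.isLowerSet_region (show ((u, 0) : State I) ≤ s from
      ⟨hu, h0 ▸ le_rfl⟩) hs) j ω
  refine ⟨_, _ ∩ _, hU, (hU O.measurableSet_region).inter (hQ (measurableSet_singleton 0).compl), ?_⟩
  filter_upwards [hne] with ω hω
  refine ⟨⟨fun hR => ?_, ?_⟩, ?_⟩
  · have hag := hagree ω _ hR (hsnd _)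
    have heq := wait_congr (a' := fun i t => O.arr i t ω) hag hω
    refine ⟨?_, ?_⟩
    · rw [Set.mem_preimage, heq]; exact hR
    · rw [Set.mem_preimage, heq, Set.mem_compl_iff, Set.mem_singleton_iff,
        queue_congr (a := fun i t => m.arr i t ω) (hag _ le_rfl)]
      exact hω
  · rintro ⟨hR, hq⟩
    have hag := hagree ω _ hR (hsnd _)
    rw [wait_congr (a := fun i t => O.arr i t ω) (fun u hu j => (hag u hu j).symm) hq]
    exact hR
  · rintro ⟨hR, hq⟩
    have hag := hagree ω _ hR (hsnd _)
    exact wait_congr (a := fun i t => O.arr i t ω) (fun u hu j => (hag u hu j).symm) hq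

end Observations


lemma isCounting_of {Ω : Type*} {σ : MeasurableSpace Ω} {N : ℝ≥0 → Ω → ℕ} (h : ∀ t, Measurable[σ] (N t))
    (hm : ∀ ω, Monotone (fun t => N t ω))
    (hr : ∀ ω t, ContinuousWithinAt (fun u => N u ω) (Set.Ici t) t) : @IsCounting Ω σ N :=
  @IsCounting.mk Ω σ N h hm hr

/-! ### Information σ-algebras, reachable states and mean balance equations. -/

section StochasticModel

variable {I : ℕ} {Ω : Type*} [mΩ : MeasurableSpace Ω] {P : Measure Ω}

namespace PollingModel

variable (m : PollingModel I P)

/-- The σ-algebras generated by the arrival processes, the service time sequences and the gating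
index sequences. -/
abbrev primitive : Fin I ⊕ Fin I ⊕ Fin I → MeasurableSpace Ω :=
  Sum.elim (fun i => MeasurableSpace.comap (fun ω t => m.arr i t ω) inferInstance)
    (Sum.elim (fun i => MeasurableSpace.comap (fun ω k => m.srv i k ω) inferInstance)
      (fun i => MeasurableSpace.comap (fun ω n => m.gate i n ω) inferInstance))

/-- The σ-algebra generated by all primitives except one. -/
abbrev others (l : Fin I ⊕ Fin I ⊕ Fin I) : MeasurableSpace Ω :=
  ⨆ l' ∈ ({l}ᶜ : Set (Fin I ⊕ Fin I ⊕ Fin I)), m.primitive l'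

lemma primitive_le (l : Fin I ⊕ Fin I ⊕ Fin I) : m.primitive l ≤ mΩ := by
  rcases l with i | i | i
  · exact (measurable_pi_iff.2 fun t => (m.arr_poisson i).measurable t).comap_le
  · exact (measurable_pi_iff.2 fun k => m.srv_measurable i k).comap_le
  · exact (measurable_pi_iff.2 fun k => m.gate_measurable i k).comap_le

lemma others_le (l : Fin I ⊕ Fin I ⊕ Fin I) : m.others l ≤ mΩ :=
  iSup₂_le fun l' _ => m.primitive_le l'

lemma primitive_le_others {l l' : Fin I ⊕ Fin I ⊕ Fin I} (h : l' ≠ l) :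
    m.primitive l' ≤ m.others l :=
  le_iSup₂_of_le (f := fun l' (_ : l' ∈ ({l}ᶜ : Set (Fin I ⊕ Fin I ⊕ Fin I))) => m.primitive l')
    l' h le_rfl

lemma indep_others (l : Fin I ⊕ Fin I ⊕ Fin I) : Indep (m.primitive l) (m.others l) P := by
  have := indep_iSup_of_disjoint m.primitive_le m.indep (S := {l}) (T := {l}ᶜ)
    disjoint_compl_right
  rwa [iSup_singleton] at this

lemma measurable_arr_primitive (i : Fin I) (t : ℝ≥0) :
    Measurable[m.primitive (Sum.inl i)] (m.arr i t) :=
  (measurable_pi_apply t).comp (comap_measurable (m := inferInstance) fun ω t => m.arr i t ω)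

lemma measurable_srv_primitive (i : Fin I) (k : ℕ) :
    Measurable[m.primitive (Sum.inr (Sum.inl i))] (m.srv i k) :=
  (measurable_pi_apply k).comp (comap_measurable (m := inferInstance) fun ω k => m.srv i k ω)

lemma measurable_gate_primitive (i : Fin I) (n : ℕ) :
    Measurable[m.primitive (Sum.inr (Sum.inr i))] (m.gate i n) :=
  (measurable_pi_apply n).comp (comap_measurable (m := inferInstance) fun ω n => m.gate i n ω)

/-- Everything is observed, except for the arrivals to queue `j` after time `t`. -/
noncomputable def arrivalsUntil (j : Fin I) (t : ℝ≥0) : Observation m where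
  arr i u := if i = j then m.arr i (min u t) else m.arr i u
  srv := m.srv
  region := {s | s.1 ≤ t}
  measurableSet_region := measurableSet_le measurable_fst measurable_const
  isLowerSet_region := fun _ _ h hs => h.1.trans hs
  arr_eq := fun s hs i ω => by
    split_ifs
    · rw [min_eq_left hs]
    · rfl
  srv_eq := fun _ _ _ _ _ _ => rfl
  info := past (m.arr j) t ⊔ m.others (Sum.inl j)
  isCounting := fun i => by
    by_cases h : i = j
    · subst h
      refine isCounting_of (fun u => ?_) (fun ω u v huv => ?_) (fun ω u => ?_)
      · simp only [if_true]
        refine Measurable.mono ?_ (le_sup_left : past (m.arr i) t ≤ _) le_rfl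
        exact measurable_iff_comap_le.2
          (le_iSup (fun u : Set.Iic t => MeasurableSpace.comap (m.arr i u) inferInstance)
            ⟨min u t, min_le_right u t⟩)
      · simp only [if_true]
        exact (m.arr_poisson i).mono ω (min_le_min_right t huv)
      · simp only [if_true]
        exact ((m.arr_poisson i).right_cont ω (min u t)).comp
          (f := fun u => min u t) (by fun_prop) fun v hv => min_le_min_right t hv
    · simp only [h, if_false]
      refine isCounting_of (fun u => ?_) (m.arr_poisson i).mono (m.arr_poisson i).right_cont
      exact (m.measurable_arr_primitive i u).mono ((m.primitive_le_others (by simpa using h)).trans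
        le_sup_right) le_rfl
  measurable_srv := fun i k => (m.measurable_srv_primitive i k).mono
    ((m.primitive_le_others (by simp)).trans le_sup_right) le_rfl

/-- Everything is observed, except for the service times at queue `j` from customer `d` on. -/
noncomputable def servicesUntil (j : Fin I) (d : ℕ) : Observation m where
  arr := m.arr
  srv i k := if i = j ∧ d ≤ k then 0 else m.srv i k
  region := {s | s.2 j ≤ d}
  measurableSet_region := measurableSet_le ((measurable_pi_apply j).comp measurable_snd)
    measurable_const
  isLowerSet_region := fun _ _ h hs => (h.2 j).trans hs
  arr_eq := fun _ _ _ _ => rfl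
  srv_eq := fun s hs i k hk ω => by
    split_ifs with h
    · obtain ⟨rfl, h⟩ := h
      exact absurd (hk.trans_le (hs.trans h)) (lt_irrefl k)
    · rfl
  info := (⨆ k : Finset.range d, MeasurableSpace.comap (m.srv j k) inferInstance) ⊔
    m.others (Sum.inr (Sum.inl j))
  isCounting := fun i => by
    refine isCounting_of (fun u => ?_) (m.arr_poisson i).mono (m.arr_poisson i).right_cont
    exact (m.measurable_arr_primitive i u).mono ((m.primitive_le_others (by simp)).trans
      le_sup_right) le_rfl
  measurable_srv := fun i k => by
    by_cases h : i = j
    · subst h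
      by_cases hk : d ≤ k
      · simp only [hk, and_self, if_true]
        exact measurable_const
      · simp only [hk, and_false, if_false]
        refine Measurable.mono ?_ (le_sup_left : (⨆ k : Finset.range d,
          MeasurableSpace.comap (m.srv i k) inferInstance) ≤ _) le_rfl
        exact measurable_iff_comap_le.2
          (le_iSup (fun k : Finset.range d => MeasurableSpace.comap (m.srv i k) inferInstance)
            ⟨k, Finset.mem_range.2 (not_le.1 hk)⟩)
    · simp only [h, false_and, if_false]
      exact (m.measurable_srv_primitive i k).mono ((m.primitive_le_others (by simpa using h)).trans
        le_sup_right) le_rfl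

/-- Everything is observed, except for the gating indices of queue `j`. -/
noncomputable def allButGate (j : Fin I) : Observation m where
  arr := m.arr
  srv := m.srv
  region := Set.univ
  measurableSet_region := MeasurableSet.univ
  isLowerSet_region := isLowerSet_univ
  arr_eq := fun _ _ _ _ => rfl
  srv_eq := fun _ _ _ _ _ _ => rfl
  info := m.others (Sum.inr (Sum.inr j))
  isCounting := fun i => by
    refine isCounting_of (fun u => ?_) (m.arr_poisson i).mono (m.arr_poisson i).right_cont
    exact (m.measurable_arr_primitive i u).mono (m.primitive_le_others (by simp)) le_rfl
  measurable_srv := fun i k => (m.measurable_srv_primitive i k).mono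
    (m.primitive_le_others (by simp)) le_rfl

variable (c : Fin I → ℕ) (T₀ : Ω → ℝ≥0)

/-- In the state `s`, only customers that have arrived have been served, and after time `T₀` the
server has worked all the time. -/
structure Consistent (ω : Ω) (s : State I) : Prop where
  departures_le : ∀ j, s.2 j ≤ c j + m.arr j s.1 ω
  time_eq : s.1 = T₀ ω + ∑ i, ∑ k ∈ Finset.range (s.2 i), m.srv i k ω

/-- A random state of the system in the course of its first session that is reached by working after
time `T₀`, and that does not depend on future arrivals, future service times, or the gating indices
of queues that are not in `K`. -/
structure Reachable (K : Set (Fin I)) (S : Ω → State I) : Prop where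
  measurable_start : Measurable T₀
  start_ne_top : ∫⁻ ω, (T₀ ω : ENNReal) ∂P ≠ ⊤
  measurable : Measurable S
  adapted : ∀ O : Observation m, (∀ i ∈ K, Measurable[O.info] (m.gate i 0)) → O.Observes S
  consistent : ∀ ω, m.Consistent c T₀ ω (S ω)
  departures_ne_top : ∀ i, ∫⁻ ω, ((S ω).2 i : ENNReal) ∂P ≠ ⊤

/-- The mean queue lengths in a random state. -/
noncomputable def meanQueue (S : Ω → State I) (j : Fin I) : ℝ :=
  (∫⁻ ω, (m.queueIn c ω (S ω) j : ENNReal) ∂P).toReal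

/-- The mean number of departures up to a random state. -/
noncomputable def meanDepartures (_m : PollingModel I P) (S : Ω → State I) (j : Fin I) : ℝ :=
  (∫⁻ ω, ((S ω).2 j : ENNReal) ∂P).toReal

variable {m c T₀} {K : Set (Fin I)} {S : Ω → State I} {ω : Ω} {s : State I}

lemma measurable_natCast_ennreal {f : Ω → ℕ} (hf : Measurable f) :
    Measurable fun ω => (f ω : ENNReal) :=
  (measurable_from_top (f := fun k : ℕ => (k : ENNReal))).comp hf

lemma lintegral_srv (m : PollingModel I P) (i : Fin I) (k : ℕ) :
    ∫⁻ ω, (m.srv i k ω : ENNReal) ∂P = ENNReal.ofReal (1 / m.mu i) := by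
  have h1 := ((m.srv_ident i k).comp (u := fun x : ℝ≥0 => (x : ENNReal))
    measurable_coe_nnreal_ennreal).lintegral_eq
  have h2 := ofReal_integral_eq_lintegral_ofReal (m.srv_integrable i)
    (Filter.Eventually.of_forall fun ω => NNReal.coe_nonneg _)
  rw [m.srv_mean] at h2
  simp only [ENNReal.ofReal_coe_nnreal] at h2
  rw [h2]
  exact h1

namespace Reachable

lemma departures_measurable (hS : m.Reachable c T₀ K S) (i : Fin I) :
    Measurable fun ω => (S ω).2 i :=
  (measurable_pi_apply i).comp hS.measurable.snd

lemma queue_measurable (hS : m.Reachable c T₀ K S) (i : Fin I) :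
    Measurable fun ω => m.queueIn c ω (S ω) i :=
  (measurable_pi_apply i).comp (measurable_queue m c hS.measurable)

variable [IsProbabilityMeasure P]

/-- By `servicesUntil`, whether at most `d` customers of queue `i` have left is decided by the
services numbered below `d` and the other primitives. It is thus independent of service `d`, as
Wald's identity requires. -/
lemma lintegral_services (hS : m.Reachable c T₀ K S) (i : Fin I) :
    ∫⁻ ω, ∑ k ∈ Finset.range ((S ω).2 i), (m.srv i k ω : ENNReal) ∂P =
      ENNReal.ofReal (1 / m.mu i) * ∫⁻ ω, ((S ω).2 i : ENNReal) ∂P := by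
  refine wald (hS.departures_measurable i) (fun k => (m.srv_measurable i k).coe_nnreal_ennreal)
    (fun k => m.lintegral_srv i k) fun d => ?_
  refine ⟨(m.servicesUntil i d).info, ?_, ?_, ?_⟩
  · exact sup_le (iSup_le fun k => (m.srv_measurable i k).comap_le) (m.others_le _)
  · have h1 : MeasurableSpace.comap (fun ω => (m.srv i d ω : ENNReal)) inferInstance ≤
        MeasurableSpace.comap (m.srv i d) inferInstance := by
      rw [← measurable_iff_comap_le]
      exact measurable_coe_nnreal_ennreal.comp (comap_measurable _)
    refine indep_of_indep_of_le_left ?_ h1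
    refine Indep.sup_right (m.srv_measurable i d).comap_le
      (iSup_le fun k => (m.srv_measurable i k).comap_le) (m.others_le _) ?_ ?_
    · have hd := indep_iSup_of_disjoint (fun k => (m.srv_measurable i k).comap_le)
        (m.srv_indep i).iIndep (S := {d}) (T := Set.Iio d) (by simp)
      rw [iSup_singleton] at hd
      refine indep_of_indep_of_le_right hd (iSup_le fun k => ?_)
      exact le_iSup₂_of_le (f := fun k (_ : k ∈ Set.Iio d) =>
        MeasurableSpace.comap (m.srv i k) inferInstance) k.1 (Finset.mem_range.1 k.2) le_rfl
    · refine indep_of_indep_of_le_left (m.indep_others _) (sup_le ?_ (iSup_le fun k => ?_))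
      · exact (m.measurable_srv_primitive i d).comap_le
      · exact (m.measurable_srv_primitive i k).comap_le
  · have hO : ∀ l ∈ K, Measurable[(m.servicesUntil i d).info] (m.gate l 0) := fun l _ =>
      (m.measurable_gate_primitive l 0).mono ((m.primitive_le_others (by simp)).trans
        le_sup_right) le_rfl
    obtain ⟨U, E, -, hE, h⟩ := hS.adapted _ hO
    exact ⟨E, hE, h.mono fun ω hω => hω.1⟩

lemma lintegral_time (hS : m.Reachable c T₀ K S) :
    ∫⁻ ω, ((S ω).1 : ENNReal) ∂P = ∫⁻ ω, (T₀ ω : ENNReal) ∂P +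
      ∑ i, ENNReal.ofReal (1 / m.mu i) * ∫⁻ ω, ((S ω).2 i : ENNReal) ∂P := by
  have hmeas : ∀ i, Measurable fun ω => ∑ k ∈ Finset.range ((S ω).2 i), (m.srv i k ω : ENNReal) :=
    fun i => measurable_natComp (f := fun n ω => ∑ k ∈ Finset.range n, (m.srv i k ω : ENNReal))
      (fun n => Finset.measurable_sum _ fun k _ => (m.srv_measurable i k).coe_nnreal_ennreal)
      (hS.departures_measurable i)
  have h1 : ∀ ω, ((S ω).1 : ENNReal) =
      T₀ ω + ∑ i, ∑ k ∈ Finset.range ((S ω).2 i), (m.srv i k ω : ENNReal) := fun ω => by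
    rw [(hS.consistent ω).time_eq]
    push_cast
    rfl
  simp_rw [h1]
  rw [lintegral_add_left hS.measurable_start.coe_nnreal_ennreal,
    lintegral_finsetSum _ fun i _ => hmeas i]
  simp_rw [hS.lintegral_services]

lemma time_ne_top (hS : m.Reachable c T₀ K S) : ∫⁻ ω, ((S ω).1 : ENNReal) ∂P ≠ ⊤ := by
  rw [hS.lintegral_time]
  refine ENNReal.add_ne_top.2 ⟨hS.start_ne_top, ENNReal.sum_ne_top.2 fun i _ => ?_⟩
  exact ENNReal.mul_ne_top ENNReal.ofReal_ne_top (hS.departures_ne_top i)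

/-- By `arrivalsUntil`, the elapsed time is a stopping time for the arrivals to queue `j`, given the
independent information in the other primitives. -/
lemma lintegral_arrivals (hS : m.Reachable c T₀ K S) (j : Fin I) :
    ∫⁻ ω, (m.arr j (S ω).1 ω : ENNReal) ∂P = m.lam j * ∫⁻ ω, ((S ω).1 : ENNReal) ∂P := by
  refine (m.arr_poisson j).lintegral_stopping (m.others_le (Sum.inl j)) ?_ hS.measurable.fst
    hS.time_ne_top fun t => ?_
  · refine indep_of_indep_of_le_left (m.indep_others (Sum.inl j)) (iSup_le fun u => ?_)
    exact (m.measurable_arr_primitive j u).comap_le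
  · have hO : ∀ l ∈ K, Measurable[(m.arrivalsUntil j t).info] (m.gate l 0) := fun l _ =>
      (m.measurable_gate_primitive l 0).mono ((m.primitive_le_others (by simp)).trans
        le_sup_right) le_rfl
    obtain ⟨U, E, -, hE, h⟩ := hS.adapted _ hO
    exact ⟨E, hE, h.mono fun ω hω => hω.1⟩

lemma lintegral_queue_add (hS : m.Reachable c T₀ K S) (j : Fin I) :
    ∫⁻ ω, (m.queueIn c ω (S ω) j : ENNReal) ∂P + ∫⁻ ω, ((S ω).2 j : ENNReal) ∂P =
      c j + m.lam j * ∫⁻ ω, ((S ω).1 : ENNReal) ∂P := by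
  rw [← hS.lintegral_arrivals, ← lintegral_add_left (measurable_natCast_ennreal
    (hS.queue_measurable j))]
  have h : ∀ ω, (m.queueIn c ω (S ω) j : ENNReal) + (S ω).2 j = c j + m.arr j (S ω).1 ω := by
    intro ω
    -- This keeps the natural subtraction in `queue` from being truncated.
    have := (hS.consistent ω).departures_le j
    have h1 : m.queueIn c ω (S ω) j + (S ω).2 j = c j + m.arr j (S ω).1 ω := by
      simp only [queue]; omega
    exact_mod_cast h1
  simp_rw [h]
  rw [lintegral_add_left measurable_const]
  simp

lemma queue_ne_top (hS : m.Reachable c T₀ K S) (j : Fin I) :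
    ∫⁻ ω, (m.queueIn c ω (S ω) j : ENNReal) ∂P ≠ ⊤ := by
  refine ne_top_of_le_ne_top ?_ (le_self_add.trans (hS.lintegral_queue_add j).le)
  exact ENNReal.add_ne_top.2 ⟨ENNReal.natCast_ne_top _,
    ENNReal.mul_ne_top ENNReal.coe_ne_top hS.time_ne_top⟩

/-- The balance of arrivals and departures. -/
lemma meanQueue_add_meanDepartures (hS : m.Reachable c T₀ K S) (j : Fin I) :
    m.meanQueue c S j + m.meanDepartures S j =
      c j + m.lam j * ((∫⁻ ω, (T₀ ω : ENNReal) ∂P).toReal + ∑ i, m.meanDepartures S i / m.mu i) := by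
  have h := congrArg ENNReal.toReal (hS.lintegral_queue_add j)
  have hβ : ∀ i, ENNReal.ofReal (1 / m.mu i) * ∫⁻ ω, ((S ω).2 i : ENNReal) ∂P ≠ ⊤ := fun i =>
    ENNReal.mul_ne_top ENNReal.ofReal_ne_top (hS.departures_ne_top i)
  rw [ENNReal.toReal_add (hS.queue_ne_top j) (hS.departures_ne_top j),
    ENNReal.toReal_add (ENNReal.natCast_ne_top _)
      (ENNReal.mul_ne_top ENNReal.coe_ne_top hS.time_ne_top), ENNReal.toReal_mul,
    hS.lintegral_time, ENNReal.toReal_add hS.start_ne_top (ENNReal.sum_ne_top.2 fun i _ => hβ i),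
    ENNReal.toReal_sum fun i _ => hβ i] at h
  simp only [ENNReal.toReal_mul, ENNReal.toReal_natCast, ENNReal.coe_toReal,
    ENNReal.toReal_ofReal (one_div_pos.2 (m.mu_pos _)).le] at h
  rw [meanQueue, meanDepartures, h]
  congr 3
  refine Finset.sum_congr rfl fun i _ => ?_
  rw [meanDepartures, one_div_mul_eq_div]

end Reachable

end PollingModel

end StochasticModel


lemma phase_eq_self {I : ℕ} {a : Fin I → ℝ≥0 → ℕ} {b : Fin I → ℕ → ℝ≥0} {c : Fin I → ℕ} {i : Fin I}
    {s : State I} (h : queue a c s i = 0) : phase a b c i s = s := by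
  simp [phase, h]

/-! ### The mean effect of phases and visits. -/

section StochasticModel

variable {I : ℕ} {Ω : Type*} [mΩ : MeasurableSpace Ω] {P : Measure Ω}

namespace PollingModel

variable {m : PollingModel I P} {c : Fin I → ℕ} {T₀ : Ω → ℝ≥0} {K : Set (Fin I)} {S : Ω → State I}
  {ω : Ω} {s : State I}

lemma Consistent.phase (hs : m.Consistent c T₀ ω s) (i : Fin I) :
    m.Consistent c T₀ ω (m.phaseFrom c i ω s) := by
  refine ⟨fun j => ?_, ?_⟩
  · have h1 := hs.departures_le j
    have h2 : m.arr j s.1 ω ≤ m.arr j (m.phaseFrom c i ω s).1 ω :=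
      (m.arr_poisson j).mono ω (le_phase i s).1
    by_cases h : j = i
    · subst h
      have : (m.phaseFrom c j ω s).2 j = s.2 j + m.queueIn c ω s j := by simp [Polling.phase]
      rw [this]
      simp only [queue]
      omega
    · have : (m.phaseFrom c i ω s).2 j = s.2 j := by simp [Polling.phase, h]
      rw [this]
      omega
  · have h1 : ∀ j, ∑ k ∈ Finset.range ((m.phaseFrom c i ω s).2 j), m.srv j k ω =
        ∑ k ∈ Finset.range (s.2 j), m.srv j k ω + if j = i then
          ∑ k ∈ Finset.range (m.queueIn c ω s i), m.srv i (s.2 i + k) ω else 0 := by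
      intro j
      by_cases h : j = i
      · subst h
        simp [Polling.phase, Finset.sum_range_add]
      · simp [Polling.phase, h]
    simp only [h1, Finset.sum_add_distrib, Finset.sum_ite_eq', Finset.mem_univ, if_true]
    rw [← add_assoc, ← hs.time_eq]
    rfl

lemma Consistent.iterate_phase (hs : m.Consistent c T₀ ω s) (i : Fin I) (k : ℕ) :
    m.Consistent c T₀ ω ((m.phaseFrom c i ω)^[k] s) := by
  induction k with
  | zero => exact hs
  | succ k ih =>
    rw [Function.iterate_succ_apply']
    exact ih.phase i

lemma snd_iterate_phase_of_ne {i j : Fin I} (h : j ≠ i) (k : ℕ) :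
    ((m.phaseFrom c i ω)^[k] s).2 j = s.2 j := by
  induction k with
  | zero => rfl
  | succ k ih => rw [Function.iterate_succ_apply', ← ih]; simp [phase, h]

lemma snd_iterate_phase_self (i : Fin I) (k : ℕ) :
    ((m.phaseFrom c i ω)^[k] s).2 i =
      s.2 i + ∑ l ∈ Finset.range k, m.queueIn c ω ((m.phaseFrom c i ω)^[l] s) i := by
  induction k with
  | zero => rfl
  | succ k ih =>
    rw [Function.iterate_succ_apply', Finset.sum_range_succ, ← add_assoc, ← ih]
    simp [phase]

/-- Phases at an empty queue change nothing, so a visit that stops early because its queue is empty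
has the same outcome as one carrying out all its permitted phases. -/
lemma iterate_phase_eq_of_queue_eq_zero {i : Fin I} {n k : ℕ} (hnk : n ≤ k)
    (h : m.queueIn c ω ((m.phaseFrom c i ω)^[n] s) i = 0) :
    (m.phaseFrom c i ω)^[k] s = (m.phaseFrom c i ω)^[n] s := by
  induction k, hnk using Nat.le_induction with
  | base => rfl
  | succ k _ ih =>
    rw [Function.iterate_succ_apply', ih]
    exact phase_eq_self h

/-- The load of queue `i`. -/
noncomputable def load (m : PollingModel I P) (i : Fin I) : ℝ := m.lam i / m.mu i

/-- The probability generating function of the gating index of queue `i`, evaluated at its load: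
the mean number of customers left behind by a visit per customer found. -/
noncomputable def gam (m : PollingModel I P) (i : Fin I) : ℝ :=
  (∑' k : ℕ, P {ω | m.gate i 0 ω = k} * ENNReal.ofReal (m.load i ^ k)).toReal

lemma load_pos (m : PollingModel I P) (i : Fin I) : 0 < m.load i :=
  div_pos (NNReal.coe_pos.2 (m.lam_pos i)) (m.mu_pos i)

lemma gam_nonneg (m : PollingModel I P) (i : Fin I) : 0 ≤ m.gam i := ENNReal.toReal_nonneg

lemma measurableSet_gate_eq (m : PollingModel I P) (i : Fin I) (k : ℕ) :
    MeasurableSet {ω | m.gate i 0 ω = k} :=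
  m.gate_measurable i 0 (MeasurableSet.of_discrete (s := {g | g = (k : ℕ∞)}))

/-- The mass at 0 has weight one, finite positive indices have weight at most `load i`, and infinity
has weight zero. Mass off 0 exists, so the weighted total drops below one. -/
lemma gam_lt_one [IsProbabilityMeasure P] (m : PollingModel I P) {i : Fin I}
    (h0 : P {ω | m.gate i 0 ω = 0} < 1) (hload : m.load i < 1) : m.gam i < 1 := by
  have hdisj : Pairwise (Function.onFun Disjoint fun k : ℕ => {ω | m.gate i 0 ω = k}) := by
    intro k l hkl
    refine Set.disjoint_left.2 fun ω hk hl => hkl ?_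
    exact_mod_cast (Eq.symm hk).trans hl
  have hsum : ∑' k : ℕ, P {ω | m.gate i 0 ω = k} ≤ 1 := by
    rw [← measure_iUnion hdisj (m.measurableSet_gate_eq i)]
    exact prob_le_one
  set p : ℕ → ENNReal := fun k => P {ω | m.gate i 0 ω = k}
  set r := ENNReal.ofReal (m.load i)
  have hr : r < 1 := by
    rw [← ENNReal.ofReal_one]
    exact (ENNReal.ofReal_lt_ofReal_iff one_pos).2 hload
  have hp0 : p 0 < 1 := by simpa [p] using h0
  rw [tsum_eq_zero_add' ENNReal.summable] at hsum
  set y := ∑' k, p (k + 1)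
  have hle : ∑' k : ℕ, p k * ENNReal.ofReal (m.load i ^ k) ≤ p 0 + r * y := by
    rw [tsum_eq_zero_add' ENNReal.summable, ← ENNReal.tsum_mul_left]
    simp only [pow_zero, ENNReal.ofReal_one, mul_one]
    refine add_le_add le_rfl (ENNReal.tsum_le_tsum fun k => ?_)
    rw [mul_comm]
    refine mul_le_mul_left ?_ _
    refine ENNReal.ofReal_le_ofReal ?_
    rw [pow_succ]
    exact mul_le_of_le_one_left (m.load_pos i).le (pow_le_one₀ (m.load_pos i).le hload.le)
  have hlt : p 0 + r * y < 1 := by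
    have hp0' : p 0 ≠ ⊤ := hp0.ne_top
    -- If `y = 0`, all mass off 0 sits at infinity and only `p 0 < 1` is left to use.
    rcases eq_or_ne y 0 with hy | hy
    · simpa [hy] using hp0
    · have hy' : y ≠ ⊤ := ne_top_of_le_ne_top ENNReal.one_ne_top (le_add_self.trans hsum)
      refine lt_of_lt_of_le ?_ hsum
      refine (ENNReal.add_lt_add_iff_left hp0').2 ?_
      conv_rhs => rw [← one_mul y]
      exact ENNReal.mul_lt_mul_left hy hy' hr
  have := (ENNReal.toReal_lt_toReal (hle.trans_lt (hlt.trans ENNReal.one_lt_top)).ne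
    ENNReal.one_ne_top).2 (hle.trans_lt hlt)
  simpa [gam, p] using this

namespace Reachable

/-- A queue outside `K` has not used its gating index: the state is determined almost surely by
`allButGate`, whose information is independent of that index. -/
lemma lintegral_queue_gate (hS : m.Reachable c T₀ K S) {i : Fin I} (hi : i ∉ K) (k : ℕ) :
    ∫⁻ ω, {ω | m.gate i 0 ω = k}.indicator (fun ω => (m.queueIn c ω (S ω) i : ENNReal)) ω ∂P =
      (∫⁻ ω, (m.queueIn c ω (S ω) i : ENNReal) ∂P) * P {ω | m.gate i 0 ω = k} := by
  let O := m.allButGate i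
  have hO : ∀ l ∈ K, Measurable[O.info] (m.gate l 0) := fun l hl =>
    (m.measurable_gate_primitive l 0).mono (m.primitive_le_others fun h => hi (by
      obtain rfl : l = i := by simpa using h
      exact hl)) le_rfl
  obtain ⟨U, E, hU, -, h⟩ := hS.adapted O hO
  have hUS : ∀ᵐ ω ∂P, S ω = U ω := h.mono fun ω hω => hω.2 (hω.1.1 (Set.mem_univ _))
  have hQ : Measurable[O.info] fun ω => (m.queueIn c ω (U ω) i : ENNReal) :=
    (measurable_from_top (f := fun k : ℕ => (k : ENNReal))).comp ((measurable_pi_apply i).comp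
      (@measurable_queue_of_isCounting I Ω O.info O.arr c O.isCounting U hU))
  have hG : MeasurableSet[m.primitive (Sum.inr (Sum.inr i))] {ω | m.gate i 0 ω = k} :=
    m.measurable_gate_primitive i 0 (MeasurableSet.of_discrete (s := {g | g = (k : ℕ∞)}))
  have key := lintegral_indicator_of_indep (m.others_le _) (m.primitive_le _) hQ
    (m.indep_others _).symm hG
  have h1 : ∫⁻ ω, (m.queueIn c ω (S ω) i : ENNReal) ∂P =
      ∫⁻ ω, (m.queueIn c ω (U ω) i : ENNReal) ∂P :=
    lintegral_congr_ae (hUS.mono fun ω hω => by simp only [hω])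
  rw [h1, ← key]
  refine lintegral_congr_ae (hUS.mono fun ω hω => ?_)
  simp only [Set.indicator_apply, hω]

variable [IsProbabilityMeasure P]

lemma phase (hS : m.Reachable c T₀ K S) (i : Fin I) :
    m.Reachable c T₀ K fun ω => m.phaseFrom c i ω (S ω) where
  measurable_start := hS.measurable_start
  start_ne_top := hS.start_ne_top
  measurable := measurable_phase m c i hS.measurable
  adapted O hO := (hS.adapted O hO).phase i
  consistent ω := (hS.consistent ω).phase i
  departures_ne_top j := by
    by_cases h : j = i
    · subst h
      have h1 : ∀ ω, ((m.phaseFrom c j ω (S ω)).2 j : ENNReal) =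
          (S ω).2 j + m.queueIn c ω (S ω) j := fun ω => by
        simp [Polling.phase]
      simp_rw [h1]
      rw [lintegral_add_left (measurable_natCast_ennreal (hS.departures_measurable j))]
      exact ENNReal.add_ne_top.2 ⟨hS.departures_ne_top j, hS.queue_ne_top j⟩
    · simpa [Polling.phase, h] using hS.departures_ne_top j

lemma iterate_phase (hS : m.Reachable c T₀ K S) (i : Fin I) (k : ℕ) :
    m.Reachable c T₀ K fun ω => (m.phaseFrom c i ω)^[k] (S ω) := by
  induction k with
  | zero => exact hS
  | succ k ih =>
    simp only [Function.iterate_succ_apply']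
    exact ih.phase i

/-- Those present leave, in mean time `meanQueue / mu i`, and the arrivals to queue `i` meanwhile
replace them. Formally, the balance equations before and after the phase are subtracted. -/
lemma meanQueue_phase (hS : m.Reachable c T₀ K S) (i : Fin I) :
    m.meanQueue c (fun ω => m.phaseFrom c i ω (S ω)) i = m.load i * m.meanQueue c S i := by
  have h1 := hS.meanQueue_add_meanDepartures i
  have h2 := (hS.phase i).meanQueue_add_meanDepartures i
  have hd : ∀ j, m.meanDepartures (fun ω => m.phaseFrom c i ω (S ω)) j =
      m.meanDepartures S j + if j = i then m.meanQueue c S i else 0 := by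
    intro j
    by_cases h : j = i
    · subst h
      have h1 : ∀ ω, ((m.phaseFrom c j ω (S ω)).2 j : ENNReal) =
          (S ω).2 j + m.queueIn c ω (S ω) j := fun ω => by
        simp [Polling.phase]
      simp only [meanDepartures, meanQueue, h1, if_true]
      rw [lintegral_add_left (measurable_natCast_ennreal (hS.departures_measurable j)),
        ENNReal.toReal_add (hS.departures_ne_top j) (hS.queue_ne_top j)]
    · simp [meanDepartures, Polling.phase, h]
  simp only [hd, add_div, Finset.sum_add_distrib, ite_div, zero_div, Finset.sum_ite_eq',
    Finset.mem_univ, if_true] at h2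
  rw [load]
  linear_combination h2 - h1

lemma lintegral_queue_iterate_phase (hS : m.Reachable c T₀ K S) (i : Fin I) (k : ℕ) :
    ∫⁻ ω, (m.queueIn c ω ((m.phaseFrom c i ω)^[k] (S ω)) i : ENNReal) ∂P =
      ENNReal.ofReal (m.load i ^ k) * ∫⁻ ω, (m.queueIn c ω (S ω) i : ENNReal) ∂P := by
  have h : m.meanQueue c (fun ω => (m.phaseFrom c i ω)^[k] (S ω)) i =
      m.load i ^ k * m.meanQueue c S i := by
    induction k with
    | zero => simp
    | succ k ih =>
      simp only [Function.iterate_succ_apply']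
      rw [(hS.iterate_phase i k).meanQueue_phase, ih]
      ring
  rw [← ENNReal.toReal_eq_toReal_iff' ((hS.iterate_phase i k).queue_ne_top i)
    (ENNReal.mul_ne_top ENNReal.ofReal_ne_top (hS.queue_ne_top i)), ENNReal.toReal_mul,
    ENNReal.toReal_ofReal (pow_nonneg (m.load_pos i).le k)]
  exact h

lemma tsum_lintegral_queue_ne_top (hS : m.Reachable c T₀ K S) {i : Fin I} (hload : m.load i < 1) :
    ∑' k : ℕ, ∫⁻ ω, (m.queueIn c ω ((m.phaseFrom c i ω)^[k] (S ω)) i : ENNReal) ∂P ≠ ⊤ := by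
  simp_rw [hS.lintegral_queue_iterate_phase]
  rw [ENNReal.tsum_mul_right]
  refine ENNReal.mul_ne_top ?_ (hS.queue_ne_top i)
  rw [← ENNReal.ofReal_tsum_of_nonneg (fun k => pow_nonneg (m.load_pos i).le k)
    (summable_geometric_of_lt_one (m.load_pos i).le hload)]
  exact ENNReal.ofReal_ne_top

/-- The mean queue lengths at successive phases form a convergent geometric series. Hence their sum
is almost surely finite, which is impossible for natural numbers that never vanish. -/
lemma ae_visit_ends (hS : m.Reachable c T₀ K S) {i : Fin I} (hload : m.load i < 1) :
    ∀ᵐ ω ∂P, ∃ k : ℕ, m.queueIn c ω ((m.phaseFrom c i ω)^[k] (S ω)) i = 0 := by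
  have h := hS.tsum_lintegral_queue_ne_top hload
  have hm : ∀ k, Measurable fun ω =>
      (m.queueIn c ω ((m.phaseFrom c i ω)^[k] (S ω)) i : ENNReal) := fun k =>
    measurable_natCast_ennreal ((hS.iterate_phase i k).queue_measurable i)
  rw [← lintegral_tsum fun k => (hm k).aemeasurable] at h
  filter_upwards [ae_lt_top (Measurable.tsum hm) h] with ω hω
  by_contra! hne
  refine hω.ne (top_unique ?_)
  rw [← ENNReal.tsum_const_eq_top_of_ne_zero (α := ℕ) one_ne_zero]
  exact ENNReal.tsum_le_tsum fun k => by
    exact_mod_cast Nat.one_le_iff_ne_zero.2 (hne k)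

lemma visit (hS : m.Reachable c T₀ K S) {i : Fin I} (hload : m.load i < 1) :
    m.Reachable c T₀ (insert i K) fun ω => m.visitFrom c i ω (S ω) where
  measurable_start := hS.measurable_start
  start_ne_top := hS.start_ne_top
  measurable := measurable_visit m c 0 i hS.measurable
  adapted O hO := (hS.adapted O fun l hl => hO l (Set.mem_insert_of_mem i hl)).visit i
    (hO i (Set.mem_insert i K)) ((hS.ae_visit_ends hload).mono fun ω ⟨k, hk⟩ => ⟨k, Or.inr hk⟩)
  consistent ω := (hS.consistent ω).iterate_phase i _
  departures_ne_top j := by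
    by_cases h : j = i
    · subst h
      -- The served customers are bounded by the total over infinitely many phases, so no control of
      -- the number of phases is needed.
      have h1 : ∀ ω, ((m.visitFrom c j ω (S ω)).2 j : ENNReal) ≤ (S ω).2 j +
          ∑' k : ℕ, (m.queueIn c ω ((m.phaseFrom c j ω)^[k] (S ω)) j : ENNReal) := fun ω => by
        simp only [Polling.visit]
        rw [snd_iterate_phase_self]
        push_cast
        exact add_le_add le_rfl (ENNReal.sum_le_tsum _)
      refine ne_top_of_le_ne_top ?_ (lintegral_mono h1)
      rw [lintegral_add_left (measurable_natCast_ennreal (hS.departures_measurable j)),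
        lintegral_tsum fun k => (measurable_natCast_ennreal
          ((hS.iterate_phase j k).queue_measurable j)).aemeasurable]
      exact ENNReal.add_ne_top.2 ⟨hS.departures_ne_top j, hS.tsum_lintegral_queue_ne_top hload⟩
    · simp only [Polling.visit, snd_iterate_phase_of_ne h]
      exact hS.departures_ne_top j

/-- The number of customers that a visit leaves behind, in terms of the gating index. -/
lemma ae_queue_visit (hS : m.Reachable c T₀ K S) {i : Fin I} (hload : m.load i < 1) :
    ∀ᵐ ω ∂P, (m.queueIn c ω (m.visitFrom c i ω (S ω)) i : ENNReal) =
      ∑' k : ℕ, {ω | m.gate i 0 ω = k}.indicator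
        (fun ω => (m.queueIn c ω ((m.phaseFrom c i ω)^[k] (S ω)) i : ENNReal)) ω := by
  filter_upwards [hS.ae_visit_ends hload] with ω ⟨l, hl⟩
  set F : ℕ → State I := fun k => (m.phaseFrom c i ω)^[k] (S ω)
  set p : ℕ → Prop := fun k => (k : ℕ∞) = m.gate i 0 ω ∨ m.queueIn c ω (F k) i = 0
  have hv : m.visitFrom c i ω (S ω) = F (sInf {k | p k}) := rfl
  set n := sInf {k | p k}
  have hn : p n := Nat.sInf_mem (s := {k | p k}) ⟨l, Or.inr hl⟩
  rw [hv]
  -- An infinite index matches no term of the sum, and such a visit can only have ended with an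
  -- empty queue.
  by_cases hg : m.gate i 0 ω = ⊤
  · have h1 : m.queueIn c ω (F n) i = 0 := hn.resolve_left (by rw [hg]; exact ENat.natCast_ne_top n)
    rw [h1, eq_comm, Nat.cast_zero, ENNReal.tsum_eq_zero]
    intro k
    refine Set.indicator_of_notMem (fun h => ?_) _
    exact ENat.natCast_ne_top k (h.symm.trans hg)
  · obtain ⟨g, hg'⟩ := ENat.ne_top_iff_exists.1 hg
    rw [tsum_eq_single g]
    · rw [Set.indicator_of_mem (show ω ∈ {ω | m.gate i 0 ω = g} from hg'.symm)]
      have hng : n ≤ g := Nat.sInf_le (Or.inl hg')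
      rcases hn with hn | hn
      · have : n = g := by exact_mod_cast hn.trans hg'.symm
        rw [this]
      · change (m.queueIn c ω (F n) i : ENNReal) = m.queueIn c ω (F g) i
        have : F g = F n := iterate_phase_eq_of_queue_eq_zero hng hn
        rw [this]
    · intro k hk
      refine Set.indicator_of_notMem (fun h => hk ?_) _
      exact_mod_cast (Eq.symm h).trans hg'.symm

lemma meanQueue_visit_self (hS : m.Reachable c T₀ K S) {i : Fin I} (hi : i ∉ K)
    (hload : m.load i < 1) :
    m.meanQueue c (fun ω => m.visitFrom c i ω (S ω)) i = m.gam i * m.meanQueue c S i := by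
  rw [meanQueue, lintegral_congr_ae (hS.ae_queue_visit hload), lintegral_tsum]
  · simp_rw [(hS.iterate_phase i _).lintegral_queue_gate hi, hS.lintegral_queue_iterate_phase]
    rw [gam, meanQueue, ← ENNReal.toReal_mul, ← ENNReal.tsum_mul_right]
    congr 1
    refine tsum_congr fun k => ?_
    ring
  · exact fun k => ((measurable_natCast_ennreal
      ((hS.iterate_phase i k).queue_measurable i)).indicator
        (m.measurableSet_gate_eq i k)).aemeasurable

end Reachable

/-- The mean duration of a visit to queue `i` per customer found there. -/
noncomputable def tau (m : PollingModel I P) (i : Fin I) : ℝ :=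
  (1 - m.gam i) / (m.mu i * (1 - m.load i))

/-- The effect of a visit to queue `i` on the vector of mean queue lengths. -/
noncomputable def visitMean (m : PollingModel I P) (i : Fin I) (v : Fin I → ℝ) : Fin I → ℝ :=
  fun j => if j = i then m.gam i * v i else v j + m.lam j * m.tau i * v i

namespace Reachable

variable [IsProbabilityMeasure P]

/-- Let `D` be the mean number served in the visit. The balance at queue `i` gives `D * (1 - load i)
= (1 - gam i) * v i`, so the visit lasts `D / mu i = tau i * v i` on average. The other queues only
collect arrivals over this time. -/
lemma meanQueue_visit (hS : m.Reachable c T₀ K S) {i : Fin I} (hi : i ∉ K)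
    (hload : m.load i < 1) :
    m.meanQueue c (fun ω => m.visitFrom c i ω (S ω)) = m.visitMean i (m.meanQueue c S) := by
  have hself := hS.meanQueue_visit_self hi hload
  have hV := hS.visit hload
  set S' : Ω → State I := fun ω => m.visitFrom c i ω (S ω)
  have hdne : ∀ j, j ≠ i → m.meanDepartures S' j = m.meanDepartures S j := fun j hj => by
    simp only [meanDepartures, S', Polling.visit, snd_iterate_phase_of_ne hj]
  have hsum : ∑ j, m.meanDepartures S' j / m.mu j = ∑ j, m.meanDepartures S j / m.mu j +
      (m.meanDepartures S' i - m.meanDepartures S i) / m.mu i := by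
    rw [← sub_eq_iff_eq_add', ← Finset.sum_sub_distrib, Finset.sum_eq_single i]
    · rw [sub_div]
    · exact fun j _ hj => by rw [hdne j hj, sub_self]
    · exact fun h => absurd (Finset.mem_univ i) h
  have hbal : ∀ j, m.meanQueue c S' j + m.meanDepartures S' j - (m.meanQueue c S j +
      m.meanDepartures S j) =
      m.lam j * ((m.meanDepartures S' i - m.meanDepartures S i) / m.mu i) := fun j => by
    rw [hS.meanQueue_add_meanDepartures, hV.meanQueue_add_meanDepartures, hsum]
    ring
  have hμ := (m.mu_pos i).ne'
  have h1 : 1 - m.load i ≠ 0 := (sub_pos.2 hload).ne'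
  have hδ : (m.meanDepartures S' i - m.meanDepartures S i) / m.mu i =
      m.tau i * m.meanQueue c S i := by
    have h2 := hbal i
    rw [hself] at h2
    have h3 : (m.meanDepartures S' i - m.meanDepartures S i) * (1 - m.load i) =
        (1 - m.gam i) * m.meanQueue c S i := by
      rw [load]
      linear_combination h2
    rw [tau, div_mul_eq_mul_div, div_eq_div_iff hμ (mul_ne_zero hμ h1)]
    linear_combination m.mu i * h3
  funext j
  by_cases hj : j = i
  · subst hj
    simp only [visitMean, if_true, hself]
  · simp only [visitMean, hj, if_false]
    have h2 := hbal j
    rw [hdne j hj, hδ] at h2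
    linear_combination h2

/-- Since `l` has no repetitions, the gating index of the next queue is still fresh at each visit,
so the one-visit formula can be iterated. -/
lemma foldl_visit (hload : ∀ i, m.load i < 1) (l : List (Fin I)) (hl : l.Nodup) :
    ∀ {K : Set (Fin I)} {S : Ω → State I}, m.Reachable c T₀ K S → (∀ i ∈ l, i ∉ K) →
      (∃ K', m.Reachable c T₀ K' fun ω => l.foldl (fun s i => m.visitFrom c i ω s) (S ω)) ∧
      m.meanQueue c (fun ω => l.foldl (fun s i => m.visitFrom c i ω s) (S ω)) =
        l.foldl (fun v i => m.visitMean i v) (m.meanQueue c S) := by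
  induction l with
  | nil => exact fun hS _ => ⟨⟨_, hS⟩, rfl⟩
  | cons i l ih =>
    intro K S hS hK
    rw [List.nodup_cons] at hl
    have hi : i ∉ K := hK i List.mem_cons_self
    have := ih hl.2 (hS.visit (hload i)) fun j hj => by
      rw [Set.mem_insert_iff, not_or]
      exact ⟨fun h => hl.1 (h ▸ hj), hK j (List.mem_cons_of_mem i hj)⟩
    simp only [List.foldl_cons]
    rw [← hS.meanQueue_visit hi (hload i)]
    exact this

end Reachable

end PollingModel

end StochasticModel


namespace PollingModel

/-! ### The initial waiting period. -/

section FirstArrival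

variable {I : ℕ} {Ω : Type*} [mΩ : MeasurableSpace Ω] {P : Measure Ω}

/-- The state at the end of the initial waiting period. -/
noncomputable abbrev startState (m : PollingModel I P) (c : Fin I → ℕ) (ω : Ω) : State I :=
  wait (fun i t => m.arr i t ω) c 0

variable {m : PollingModel I P} {c : Fin I → ℕ}

lemma startState_snd (m : PollingModel I P) (c : Fin I → ℕ) (ω : Ω) : (m.startState c ω).2 = 0 := by
  unfold startState wait; split_ifs <;> rfl

lemma reachable_startState (hne : ∀ᵐ ω ∂P, m.queueIn c ω (m.startState c ω) ≠ 0)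
    (hfin : ∫⁻ ω, ((m.startState c ω).1 : ENNReal) ∂P ≠ ⊤) :
    m.Reachable c (fun ω => (m.startState c ω).1) ∅ (m.startState c) where
  measurable_start := (measurable_wait m c measurable_const).fst
  start_ne_top := hfin
  measurable := measurable_wait m c measurable_const
  adapted O _ := O.observes_wait hne
  consistent ω := by
    refine ⟨fun j => ?_, ?_⟩ <;> rw [startState_snd] <;> simp
  departures_ne_top i := by
    simp [startState_snd]

lemma queueIn_zero (m : PollingModel I P) (c : Fin I → ℕ) (ω : Ω) : m.queueIn c ω 0 = c := by
  funext j
  have := (m.arr_poisson j).zero ω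
  simpa [queue] using this

lemma startState_of_ne_zero (hc : c ≠ 0) (ω : Ω) : m.startState c ω = 0 := by
  have h := m.queueIn_zero c ω
  simp only [startState, wait]
  rw [if_neg]
  intro h'
  exact hc (h.symm.trans h')

lemma reachable_of_ne_zero (hc : c ≠ 0) :
    m.Reachable c (fun ω => (m.startState c ω).1) ∅ (m.startState c) := by
  refine reachable_startState (Filter.Eventually.of_forall fun ω => ?_) ?_
  · rw [startState_of_ne_zero hc, queueIn_zero]
    exact hc
  · simp [startState_of_ne_zero hc]

lemma meanQueue_startState_of_ne_zero [IsProbabilityMeasure P] (hc : c ≠ 0) (j : Fin I) :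
    m.meanQueue c (m.startState c) j = c j := by
  simp only [meanQueue, startState_of_ne_zero hc, queueIn_zero]
  simp

lemma measure_arr_eq_zero (m : PollingModel I P) (i : Fin I) (n : ℕ) :
    P {ω | m.arr i n ω = 0} = ENNReal.ofReal (Real.exp (-m.lam i) ^ n) := by
  have hl := (m.arr_poisson i).law_increment 0 n
  have h1 : (fun ω => m.arr i (0 + n) ω - m.arr i 0 ω) = m.arr i n := by
    funext ω
    rw [(m.arr_poisson i).zero, zero_add, Nat.sub_zero]
  rw [h1] at hl
  have h2 := Measure.map_apply (μ := P) ((m.arr_poisson i).measurable n)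
    (measurableSet_singleton (0 : ℕ))
  rw [hl.map_eq, poissonMeasure_singleton] at h2
  rw [show {ω | m.arr i n ω = 0} = m.arr i n ⁻¹' {0} from rfl, ← h2, ← Real.exp_nat_mul]
  congr 1
  simp [mul_comm]

/-- The number of integer times before the first arrival to queue `i`. -/
noncomputable def idleCount (m : PollingModel I P) (i : Fin I) (ω : Ω) : ENNReal :=
  ∑' n : ℕ, {ω | m.arr i n ω = 0}.indicator 1 ω

lemma measurable_idleCount (m : PollingModel I P) (i : Fin I) : Measurable (m.idleCount i) :=
  Measurable.tsum fun n => measurable_one.indicator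
    ((m.arr_poisson i).measurable n (measurableSet_singleton 0))

/-- The probability of no arrival by time `n` is `exp (-lam i) ^ n`, a summable geometric sequence.
-/
lemma lintegral_idleCount_ne_top (m : PollingModel I P) (i : Fin I) :
    ∫⁻ ω, m.idleCount i ω ∂P ≠ ⊤ := by
  have hm : ∀ n : ℕ, MeasurableSet {ω | m.arr i n ω = 0} := fun n =>
    (m.arr_poisson i).measurable n (measurableSet_singleton 0)
  unfold idleCount
  rw [lintegral_tsum fun n => (measurable_one.indicator (hm n)).aemeasurable]
  simp_rw [lintegral_indicator_one (hm _), measure_arr_eq_zero]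
  rw [← ENNReal.ofReal_tsum_of_nonneg (fun n => by positivity)
    (summable_geometric_of_lt_one (Real.exp_pos _).le (Real.exp_lt_one_iff.2 (by
      simpa using m.lam_pos i)))]
  exact ENNReal.ofReal_ne_top

lemma ae_exists_arrival (m : PollingModel I P) (i : Fin I) :
    ∀ᵐ ω ∂P, ∃ n : ℕ, m.arr i n ω ≠ 0 := by
  filter_upwards [ae_lt_top (m.measurable_idleCount i) (m.lintegral_idleCount_ne_top i)] with ω hω
  by_contra! h
  refine hω.ne ?_
  have : ∀ n : ℕ, {ω | m.arr i n ω = 0}.indicator (1 : Ω → ENNReal) ω = 1 := fun n =>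
    Set.indicator_of_mem (h n) 1
  simp only [idleCount, this]
  exact ENNReal.tsum_const_eq_top_of_ne_zero one_ne_zero

lemma startState_zero_fst (m : PollingModel I P) (ω : Ω) : (m.startState 0 ω).1 =
    sInf {u : ℝ≥0 | 0 ≤ u ∧ m.queueIn 0 ω (u, 0) ≠ 0} := by
  simp only [startState, wait]
  rw [if_pos (m.queueIn_zero 0 ω)]
  rfl

/-- Every integer time before the end of the wait is free of arrivals to queue `i`. This crude count
gives a finite mean waiting time without computing its law. -/
lemma startState_zero_le_idleCount (m : PollingModel I P) (i : Fin I) (ω : Ω) :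
    ((m.startState 0 ω).1 : ENNReal) ≤ m.idleCount i ω := by
  set T := (m.startState 0 ω).1 with hT
  rw [startState_zero_fst] at hT
  calc (T : ENNReal) ≤ ((⌈T⌉₊ : ℕ) : ENNReal) := by exact_mod_cast Nat.le_ceil T
    _ = ∑ n ∈ Finset.range ⌈T⌉₊, 1 := by simp
    _ = ∑ n ∈ Finset.range ⌈T⌉₊, {ω | m.arr i n ω = 0}.indicator (1 : Ω → ENNReal) ω := by
      refine Finset.sum_congr rfl fun n hn => ?_
      rw [Set.indicator_of_mem, Pi.one_apply]
      have hlt : (n : ℝ≥0) < T := Nat.lt_ceil.1 (Finset.mem_range.1 hn)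
      by_contra h
      refine not_le.2 hlt (hT.trans_le (csInf_le (OrderBot.bddBelow _) ⟨zero_le, fun h' => h ?_⟩))
      simpa [queue] using congrFun h' i
    _ ≤ m.idleCount i ω := ENNReal.sum_le_tsum _

/-- If the system were empty at the infimum, right-continuity would keep it empty for a while
longer, contradicting the infimum. -/
lemma queueIn_startState_zero_ne {ω : Ω} {i : Fin I} {n : ℕ} (h : m.arr i n ω ≠ 0) :
    m.queueIn 0 ω (m.startState 0 ω) ≠ 0 := by
  set A := {u : ℝ≥0 | 0 ≤ u ∧ m.queueIn 0 ω (u, 0) ≠ 0}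
  have hne : A.Nonempty := ⟨n, zero_le, fun h' => h (by simpa [queue] using congrFun h' i)⟩
  have hT : m.startState 0 ω = (sInf A, 0) :=
    Prod.ext (m.startState_zero_fst ω) (m.startState_snd 0 ω)
  rw [hT]
  intro h0
  have hev : ∀ᶠ u in nhdsWithin (sInf A) (Set.Ici (sInf A)), ∀ j, m.arr j u ω = 0 := by
    refine Filter.eventually_all.2 fun j => ?_
    have h1 := ((m.arr_poisson j).right_cont ω (sInf A)).eventually
      (IsOpen.eventually_mem (isOpen_discrete {0})
        (show m.arr j (sInf A) ω ∈ ({0} : Set ℕ) by simpa [queue] using congrFun h0 j))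
    exact h1
  obtain ⟨ε, hε, hball⟩ := Metric.mem_nhdsWithin_iff.1 hev
  obtain ⟨u, hu, hlt⟩ := (csInf_lt_iff (OrderBot.bddBelow A) hne).1
    (show sInf A < sInf A + ⟨ε, hε.le⟩ from lt_add_of_pos_right _ hε)
  have hge : sInf A ≤ u := csInf_le (OrderBot.bddBelow A) hu
  have hmem : ∀ j, m.arr j u ω = 0 := by
    refine hball ⟨?_, hge⟩
    rw [Metric.mem_ball, NNReal.dist_eq, abs_of_nonneg (sub_nonneg.2 (NNReal.coe_le_coe.2 hge)),
      sub_lt_iff_lt_add']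
    exact NNReal.coe_lt_coe.2 hlt
  refine hu.2 (funext fun j => ?_)
  simpa [queue] using hmem j

lemma ae_queueIn_startState_zero_ne (m : PollingModel I P) (i : Fin I) :
    ∀ᵐ ω ∂P, m.queueIn 0 ω (m.startState 0 ω) ≠ 0 :=
  (m.ae_exists_arrival i).mono fun _ ⟨_, hn⟩ => queueIn_startState_zero_ne hn

lemma reachable_zero (m : PollingModel I P) (i : Fin I) :
    m.Reachable 0 (fun ω => (m.startState 0 ω).1) ∅ (m.startState 0) :=
  reachable_startState (m.ae_queueIn_startState_zero_ne i)
    (ne_top_of_le_ne_top (m.lintegral_idleCount_ne_top i)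
      (lintegral_mono (m.startState_zero_le_idleCount i)))

lemma meanQueue_nonneg (m : PollingModel I P) (c : Fin I → ℕ) (S : Ω → State I) (j : Fin I) :
    0 ≤ m.meanQueue c S j := ENNReal.toReal_nonneg

lemma exists_meanQueue_startState_zero_pos [IsProbabilityMeasure P] (m : PollingModel I P)
    (i : Fin I) : ∃ j, 0 < m.meanQueue 0 (m.startState 0) j := by
  by_contra! h
  have hR := m.reachable_zero i
  have h0 : ∀ j, ∀ᵐ ω ∂P, m.queueIn 0 ω (m.startState 0 ω) j = 0 := by
    intro j
    have h1 : ∫⁻ ω, (m.queueIn 0 ω (m.startState 0 ω) j : ENNReal) ∂P = 0 := by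
      have := le_antisymm (h j) (m.meanQueue_nonneg 0 (m.startState 0) j)
      exact ((ENNReal.toReal_eq_zero_iff _).1 this).resolve_right (hR.queue_ne_top j)
    have h2 := (lintegral_eq_zero_iff (measurable_natCast_ennreal (hR.queue_measurable j))).1 h1
    filter_upwards [h2] with ω hω
    exact (Nat.cast_eq_zero (R := ENNReal)).1 hω
  obtain ⟨ω, hω, hω'⟩ := ((ae_all_iff.2 h0).and (m.ae_queueIn_startState_zero_ne i)).exists
  exact hω' (funext hω)

end FirstArrival

/-! ### The mean matrix as a composition of visits. -/

section MeanMatrix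

variable {I : ℕ} {Ω : Type*} [mΩ : MeasurableSpace Ω] {P : Measure Ω} [IsProbabilityMeasure P]
  {m : PollingModel I P} {c : Fin I → ℕ} {T₀ : Ω → ℝ≥0}

lemma lintegral_queueAt (hload : ∀ i, m.load i < 1)
    (hS : m.Reachable c T₀ ∅ (m.startState c)) (j : Fin I) :
    ∫⁻ ω, (m.queueAt c 1 ω j : ENNReal) ∂P = ENNReal.ofReal
      ((List.finRange I).foldl (fun v i => m.visitMean i v) (m.meanQueue c (m.startState c)) j) := by
  obtain ⟨⟨K, hR⟩, hM⟩ := Reachable.foldl_visit hload (List.finRange I) (List.nodup_finRange I) hS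
    (fun _ _ => Set.notMem_empty _)
  rw [← hM, meanQueue, ENNReal.ofReal_toReal (hR.queue_ne_top j)]
  rfl

lemma meanQueue_foldl_nonneg (hload : ∀ i, m.load i < 1)
    (hS : m.Reachable c T₀ ∅ (m.startState c)) (j : Fin I) :
    0 ≤ (List.finRange I).foldl (fun v i => m.visitMean i v)
      (m.meanQueue c (m.startState c)) j := by
  obtain ⟨-, hM⟩ := Reachable.foldl_visit hload (List.finRange I) (List.nodup_finRange I) hS
    (fun _ _ => Set.notMem_empty _)
  rw [← hM]
  exact m.meanQueue_nonneg _ _ _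

lemma meanQueue_single (m : PollingModel I P) (i : Fin I) :
    m.meanQueue (Pi.single i 1) (m.startState (Pi.single i 1)) = Pi.single i 1 := by
  funext j
  rw [meanQueue_startState_of_ne_zero (by simp)]
  by_cases h : j = i
  · subst h; simp
  · simp [h]

lemma integrable_sessionOffspring (hload : ∀ i, m.load i < 1) (i j : Fin I) :
    Integrable (fun ω => (m.sessionOffspring i ω j : ℝ)) P := by
  have hmeas : Measurable fun ω => m.sessionOffspring i ω j :=
    (measurable_pi_apply j).comp (measurable_queueAt m _ 1)
  refine ⟨((measurable_from_top (f := fun k : ℕ => (k : ℝ))).comp hmeas).aestronglyMeasurable, ?_⟩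
  rw [hasFiniteIntegral_iff_ofReal (Filter.Eventually.of_forall fun ω => Nat.cast_nonneg _)]
  simp only [ENNReal.ofReal_natCast]
  rw [sessionOffspring, lintegral_queueAt hload (reachable_of_ne_zero (by simp))]
  exact ENNReal.ofReal_lt_top

lemma meanMatrix_apply (hload : ∀ i, m.load i < 1) (i j : Fin I) :
    m.meanMatrix i j =
      (List.finRange I).foldl (fun v i => m.visitMean i v) (Pi.single i 1) j := by
  have hS := reachable_of_ne_zero (m := m) (c := Pi.single i 1) (by simp)
  rw [meanMatrix, Matrix.of_apply, integral_eq_lintegral_of_nonneg_ae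
    (Filter.Eventually.of_forall fun ω => Nat.cast_nonneg _)
    (integrable_sessionOffspring hload i j).aestronglyMeasurable]
  simp only [ENNReal.ofReal_natCast]
  rw [sessionOffspring, lintegral_queueAt hload hS, ENNReal.toReal_ofReal
    (meanQueue_foldl_nonneg hload hS j), meanQueue_single]

end MeanMatrix

/-! ### Growth of mean work and positivity under visits. -/

section VisitMean

variable {I : ℕ} {Ω : Type*} [mΩ : MeasurableSpace Ω] {P : Measure Ω} {m : PollingModel I P}
  {v : Fin I → ℝ}

/-- The mean amount of work in a system with mean queue lengths `v`. -/
noncomputable def work (m : PollingModel I P) (v : Fin I → ℝ) : ℝ := ∑ j, v j * (1 / m.mu j)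

lemma tau_pos (hgam : ∀ i, m.gam i < 1) (hload : ∀ i, m.load i < 1) (i : Fin I) : 0 < m.tau i :=
  div_pos (sub_pos.2 (hgam i)) (mul_pos (m.mu_pos i) (sub_pos.2 (hload i)))

/-- Over the mean duration `tau i * v i` of the visit, work enters at rate `∑ load j` and leaves at
rate one. -/
lemma work_visitMean (hload : ∀ i, m.load i < 1) (i : Fin I) :
    m.work (m.visitMean i v) = m.work v + m.tau i * v i * (∑ j, m.load j - 1) := by
  have h1 : ∀ j, m.visitMean i v j * (1 / m.mu j) = v j * (1 / m.mu j) +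
      m.tau i * v i * m.load j +
      if j = i then (m.gam i - 1) * v i / m.mu i - m.tau i * v i * m.load i else 0 := by
    intro j
    by_cases h : j = i
    · subst h
      simp only [visitMean, if_true]
      ring
    · simp only [visitMean, h, if_false, load]
      ring
  have h2 : (m.gam i - 1) * v i / m.mu i = - (m.tau i * v i * (1 - m.load i)) := by
    have hμ := (m.mu_pos i).ne'
    have h1 : 1 - m.load i ≠ 0 := (sub_pos.2 (hload i)).ne'
    rw [tau]
    field_simp
    ring
  simp only [work, h1, Finset.sum_add_distrib, Finset.sum_ite_eq', Finset.mem_univ, if_true, h2]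
  rw [← Finset.mul_sum]
  ring

section

variable (hgam : ∀ i, m.gam i < 1) (hload : ∀ i, m.load i < 1)
include hgam hload

lemma visitMean_nonneg (hv : ∀ j, 0 ≤ v j) (i j : Fin I) : 0 ≤ m.visitMean i v j := by
  simp only [visitMean]
  split_ifs
  · exact mul_nonneg (m.gam_nonneg i) (hv i)
  · exact add_nonneg (hv j) (mul_nonneg (mul_nonneg (NNReal.coe_nonneg _)
      (tau_pos hgam hload i).le) (hv i))

lemma le_visitMean (hv : ∀ j, 0 ≤ v j) {i j : Fin I} (h : j ≠ i) : v j ≤ m.visitMean i v j := by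
  simp only [visitMean, h, if_false]
  exact le_add_of_nonneg_right (mul_nonneg (mul_nonneg (NNReal.coe_nonneg _)
      (tau_pos hgam hload i).le) (hv i))

lemma visitMean_pos (hv : ∀ j, 0 ≤ v j) {i j : Fin I} (h : j ≠ i) (hi : 0 < v i) :
    0 < m.visitMean i v j := by
  simp only [visitMean, h, if_false]
  exact add_pos_of_nonneg_of_pos (hv j) (mul_pos (mul_pos (NNReal.coe_pos.2 (m.lam_pos j))
      (tau_pos hgam hload i)) hi)

lemma le_foldl_visitMean {j : Fin I} (l : List (Fin I)) (hj : j ∉ l) :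
    ∀ {v : Fin I → ℝ}, (∀ j, 0 ≤ v j) → v j ≤ l.foldl (fun v i => m.visitMean i v) v j := by
  induction l with
  | nil => exact fun _ => le_rfl
  | cons i l ih =>
    intro v hv
    rw [List.mem_cons, not_or] at hj
    exact (le_visitMean hgam hload hv hj.1).trans
      (ih hj.2 (visitMean_nonneg hgam hload hv i))

/-- Queue `k` stays positive until it is visited; that visit lasts a positive mean time and brings
arrivals to `j`, which are not served within `l`. -/
lemma foldl_visitMean_pos {j k : Fin I} (l : List (Fin I)) (hj : j ∉ l) (hk : k ∈ l) :
    ∀ {v : Fin I → ℝ}, (∀ j, 0 ≤ v j) → 0 < v k →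
      0 < l.foldl (fun v i => m.visitMean i v) v j := by
  induction l with
  | nil => exact absurd hk List.not_mem_nil
  | cons i l ih =>
    intro v hv hvk
    rw [List.mem_cons, not_or] at hj
    by_cases hki : k = i
    · subst hki
      exact (visitMean_pos hgam hload hv hj.1 hvk).trans_le
        (le_foldl_visitMean hgam hload l hj.2 (visitMean_nonneg hgam hload hv k))
    · exact ih hj.2 ((List.mem_cons.1 hk).resolve_left hki) (visitMean_nonneg hgam hload hv i)
        (hvk.trans_le (le_visitMean hgam hload hv hki))

variable (hover : 1 < ∑ j, m.load j)
include hover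

lemma work_le_foldl (l : List (Fin I)) :
    ∀ {v : Fin I → ℝ}, (∀ j, 0 ≤ v j) →
      m.work v ≤ m.work (l.foldl (fun v i => m.visitMean i v) v) := by
  induction l with
  | nil => exact fun _ => le_rfl
  | cons i l ih =>
    intro v hv
    refine le_trans ?_ (ih (visitMean_nonneg hgam hload hv i))
    rw [work_visitMean hload]
    exact le_add_of_nonneg_right (mul_nonneg (mul_nonneg (tau_pos hgam hload i).le (hv i))
      (sub_pos.2 hover).le)

/-- Every visit weakly increases work under overload. The first visit to `k` does so strictly, as
queue `k` can only have grown before it. -/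
lemma work_lt_foldl {k : Fin I} (l : List (Fin I)) (hk : k ∈ l) :
    ∀ {v : Fin I → ℝ}, (∀ j, 0 ≤ v j) → 0 < v k →
      m.work v < m.work (l.foldl (fun v i => m.visitMean i v) v) := by
  induction l with
  | nil => exact absurd hk List.not_mem_nil
  | cons i l ih =>
    intro v hv hvk
    have hv' := visitMean_nonneg hgam hload hv i
    by_cases hki : k = i
    · subst hki
      refine lt_of_lt_of_le ?_ (work_le_foldl hgam hload hover l hv')
      rw [work_visitMean hload]
      exact lt_add_of_pos_right _ (mul_pos (mul_pos (tau_pos hgam hload k) hvk) (sub_pos.2 hover))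
    · refine lt_of_le_of_lt ?_ (ih ((List.mem_cons.1 hk).resolve_left hki) hv'
        (hvk.trans_le (le_visitMean hgam hload hv hki)))
      rw [work_visitMean hload]
      exact le_add_of_nonneg_right (mul_nonneg (mul_nonneg (tau_pos hgam hload i).le (hv i))
        (sub_pos.2 hover).le)

end

end VisitMean

/-! ### Strict growth and column structure of the mean matrix. -/

section MeanMatrix

variable {I : ℕ} {Ω : Type*} [mΩ : MeasurableSpace Ω] {P : Measure Ω} [IsProbabilityMeasure P]
  {m : PollingModel I P}

lemma single_one_nonneg (i j : Fin I) : (0 : ℝ) ≤ (Pi.single i 1 : Fin I → ℝ) j := by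
  by_cases h : j = i
  · subst h; simp
  · simp [h]

lemma lt_sum_meanMatrix_mul (hgam : ∀ i, m.gam i < 1) (hload : ∀ i, m.load i < 1)
    (hover : 1 < ∑ j, m.load j) (i : Fin I) :
    1 / m.mu i < ∑ j, m.meanMatrix i j * (1 / m.mu j) := by
  have h := work_lt_foldl hgam hload hover (List.finRange I) (List.mem_finRange i)
    (single_one_nonneg i) (by simp)
  have h1 : m.work (Pi.single i 1) = 1 / m.mu i := by
    simp [work, Pi.single_apply]
  rw [h1] at h
  simp_rw [meanMatrix_apply hload]
  exact h

/-- Only the column of the queue that is visited last can vanish. -/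
lemma meanMatrix_column (hgam : ∀ i, m.gam i < 1) (hload : ∀ i, m.load i < 1) (j : Fin I) :
    (∀ i, 0 < m.meanMatrix i j) ∨ ∀ i, m.meanMatrix i j = 0 := by
  obtain _ | n := I
  · exact j.elim0
  -- The session is split into `l`, the visits before the last one, and the visit to `Fin.last n`.
  set l := (List.finRange n).map Fin.castSucc
  set u : Fin (n + 1) → Fin (n + 1) → ℝ := fun i =>
    l.foldl (fun v i => m.visitMean i v) (Pi.single i 1)
  have hM : ∀ i j, m.meanMatrix i j = m.visitMean (Fin.last n) (u i) j := fun i j => by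
    rw [meanMatrix_apply hload, List.finRange_succ_last, List.foldl_append]
    rfl
  have hlast : Fin.last n ∉ l := by
    simp [l, Fin.castSucc_ne_last]
  have hnonneg : ∀ (l : List (Fin (n + 1))) (v : Fin (n + 1) → ℝ), (∀ j, 0 ≤ v j) →
      ∀ j, 0 ≤ l.foldl (fun v i => m.visitMean i v) v j := by
    intro l
    induction l with
    | nil => exact fun v hv => hv
    | cons i l ih => exact fun v hv => ih _ (visitMean_nonneg hgam hload hv i)
  -- Just before its visit the last queue has positive mean, so that visit reaches every other
  -- column; its own column is `gam` times a positive vector.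
  have hpos : ∀ i, 0 < u i (Fin.last n) := fun i => by
    rcases Fin.eq_castSucc_or_eq_last i with ⟨k, rfl⟩ | rfl
    · exact foldl_visitMean_pos hgam hload l hlast (k := k.castSucc) (by simp [l])
        (single_one_nonneg _) (by simp)
    · exact lt_of_lt_of_le (by simp) (le_foldl_visitMean hgam hload l hlast (single_one_nonneg _))
  by_cases hj : j = Fin.last n
  · subst hj
    simp only [hM, visitMean, if_true]
    rcases (m.gam_nonneg (Fin.last n)).eq_or_lt with h | h
    · right
      intro i
      rw [← h, zero_mul]
    · exact Or.inl fun i => mul_pos h (hpos i)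
  · left
    intro i
    rw [hM]
    exact visitMean_pos hgam hload (hnonneg l _ (single_one_nonneg i)) hj (hpos i)

/-- An almost surely empty end would mean zero final work, but mean work strictly increases from its
nonnegative value at the first arrival. -/
lemma measure_queueAt_zero_ne_zero (hgam : ∀ i, m.gam i < 1) (hload : ∀ i, m.load i < 1)
    (hover : 1 < ∑ j, m.load j) : P {ω | m.queueAt 0 1 ω ≠ 0} ≠ 0 := by
  intro h0
  have hI : 0 < I := by
    rcases Nat.eq_zero_or_pos I with rfl | h
    · simp at hover; linarith
    · exact h
  have hS := m.reachable_zero ⟨0, hI⟩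
  have hae : ∀ᵐ ω ∂P, m.queueAt 0 1 ω = 0 := by simpa [ae_iff] using h0
  obtain ⟨k, hk⟩ := m.exists_meanQueue_startState_zero_pos ⟨0, hI⟩
  have hlt := work_lt_foldl hgam hload hover (List.finRange I) (List.mem_finRange k)
    (m.meanQueue_nonneg 0 (m.startState 0)) hk
  have hzero : (List.finRange I).foldl (fun v i => m.visitMean i v)
      (m.meanQueue 0 (m.startState 0)) = 0 := by
    funext j
    refine le_antisymm ?_ (meanQueue_foldl_nonneg hload hS j)
    refine ENNReal.ofReal_eq_zero.1 ?_
    rw [← lintegral_queueAt hload hS]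
    refine (lintegral_congr_ae (g := fun _ => 0) (hae.mono fun ω hω => ?_)).trans lintegral_zero
    simp [hω]
  rw [hzero] at hlt
  have h1 : m.work 0 = 0 := by simp [work]
  rw [h1] at hlt
  exact absurd hlt (not_lt.2 (Finset.sum_nonneg fun j _ =>
    mul_nonneg (m.meanQueue_nonneg _ _ j) (one_div_pos.2 (m.mu_pos j)).le))

end MeanMatrix

end PollingModel


/-! ### Perron-Frobenius eigenvalues -/

section PerronFrobenius

open Matrix

variable {I : ℕ} {M : Matrix (Fin I) (Fin I) ℝ}

lemma exists_gt_of_forall_lt {y z : Fin I → ℝ} {r : ℝ} (h : ∀ i, r * y i < z i) :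
    ∃ r', r < r' ∧ ∀ i, r' * y i ≤ z i := by
  have hev : ∀ᶠ r' in nhds r, ∀ i, r' * y i < z i := by
    refine Filter.eventually_all.2 fun i => ?_
    exact (continuous_id.mul continuous_const).continuousAt.eventually_lt continuousAt_const (h i)
  obtain ⟨r', h1, h2⟩ := ((hev.filter_mono nhdsWithin_le_nhds).and
    (self_mem_nhdsWithin (s := Set.Ioi r))).exists
  exact ⟨r', h2, fun i => (h1 i).le⟩

/-- This is the Collatz–Wielandt variational problem: after normalising vectors to the simplex, `r`
is maximised over a compact set, and `w` shows that the set is nonempty. -/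
lemma exists_maximal_subinvariant (hM : ∀ i j, 0 ≤ M i j) {w : Fin I → ℝ} (hw : ∀ i, 0 ≤ w i)
    (hw0 : w ≠ 0) (hMw : ∀ i, w i ≤ (M *ᵥ w) i) :
    ∃ ρ, 1 ≤ ρ ∧ (∃ x : Fin I → ℝ, (∀ i, 0 ≤ x i) ∧ x ≠ 0 ∧ ∀ i, ρ * x i ≤ (M *ᵥ x) i) ∧
      ∀ r, 1 ≤ r → ∀ y : Fin I → ℝ, (∀ i, 0 ≤ y i) → y ≠ 0 → (∀ i, r * y i ≤ (M *ᵥ y) i) →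
        r ≤ ρ := by
  -- Summing `r * x i ≤ (M *ᵥ x) i` over the simplex bounds `r` by the sum of all entries.
  set R := ∑ i, ∑ j, M i j
  set A : Set (ℝ × (Fin I → ℝ)) :=
    (Set.Icc 1 R ×ˢ stdSimplex ℝ (Fin I)) ∩ {p | ∀ i, p.1 * p.2 i ≤ (M *ᵥ p.2) i}
  have hA : IsCompact A := by
    refine (isCompact_Icc.prod (isCompact_stdSimplex ℝ (Fin I))).inter_right ?_
    simp only [Set.ofPred_forall]
    refine isClosed_iInter fun i => isClosed_le (by fun_prop) ?_
    simp only [mulVec, dotProduct]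
    fun_prop
  have hmem : ∀ r, 1 ≤ r → ∀ y : Fin I → ℝ, (∀ i, 0 ≤ y i) → y ≠ 0 →
      (∀ i, r * y i ≤ (M *ᵥ y) i) → ∃ x, (r, x) ∈ A := by
    intro r hr y hy hy0 hry
    have hs : 0 < ∑ i, y i := by
      obtain ⟨k, hk⟩ := Function.ne_iff.1 hy0
      exact Finset.sum_pos' (fun i _ => hy i)
        ⟨k, Finset.mem_univ k, lt_of_le_of_ne (hy k) (Ne.symm hk)⟩
    set x : Fin I → ℝ := (∑ i, y i)⁻¹ • y
    have hx : x ∈ stdSimplex ℝ (Fin I) := by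
      refine ⟨fun i => mul_nonneg (inv_nonneg.2 hs.le) (hy i), ?_⟩
      simp only [x, Pi.smul_apply, smul_eq_mul, ← Finset.mul_sum]
      exact inv_mul_cancel₀ hs.ne'
    have hrx : ∀ i, r * x i ≤ (M *ᵥ x) i := fun i => by
      simp only [x, mulVec_smul, Pi.smul_apply, smul_eq_mul]
      rw [mul_left_comm]
      exact mul_le_mul_of_nonneg_left (hry i) (inv_nonneg.2 hs.le)
    refine ⟨x, ⟨⟨hr, ?_⟩, hx⟩, hrx⟩
    calc r = ∑ i, r * x i := by rw [← Finset.mul_sum, hx.2, mul_one]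
      _ ≤ ∑ i, (M *ᵥ x) i := Finset.sum_le_sum fun i _ => hrx i
      _ ≤ R := Finset.sum_le_sum fun i _ => by
        simp only [mulVec, dotProduct]
        exact Finset.sum_le_sum fun j _ => mul_le_of_le_one_right (hM i j)
          ((Finset.single_le_sum (fun k _ => hx.1 k) (Finset.mem_univ j)).trans hx.2.le)
  obtain ⟨x₁, hx₁⟩ := hmem 1 le_rfl w hw hw0 (by simpa using hMw)
  obtain ⟨⟨ρ, x⟩, hx, hmax⟩ := hA.exists_isMaxOn ⟨_, hx₁⟩ continuous_fst.continuousOn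
  refine ⟨ρ, hx.1.1.1, ⟨x, hx.1.2.1, ?_, hx.2⟩, fun r hr y hy hy0 hry => ?_⟩
  · rintro rfl
    simpa using hx.1.2.2
  · obtain ⟨x', hx'⟩ := hmem r hr y hy hy0 hry
    exact hmax hx'

lemma mulVec_pos_of_column (hM : ∀ i j, 0 ≤ M i j) {x : Fin I → ℝ} (hx : ∀ i, 0 ≤ x i)
    {j : Fin I} (hj : ∀ i, 0 < M i j) (hxj : 0 < x j) (i : Fin I) : 0 < (M *ᵥ x) i :=
  Finset.sum_pos' (fun k _ => mul_nonneg (hM i k) (hx k))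
    ⟨j, Finset.mem_univ j, mul_pos (hj i) hxj⟩

lemma mulVec_eq_zero_of_column {𝕜 : Type*} [Semiring 𝕜] {M : Matrix (Fin I) (Fin I) 𝕜}
    {x : Fin I → 𝕜} (h : ∀ j, (∃ i, M i j ≠ 0) → x j = 0) : M *ᵥ x = 0 := by
  funext i
  simp only [mulVec, dotProduct, Pi.zero_apply]
  refine Finset.sum_eq_zero fun j _ => ?_
  by_cases hij : M i j = 0
  · rw [hij, zero_mul]
  · rw [h j ⟨i, hij⟩, mul_zero]

/-- A nonnegative matrix all of whose columns are positive or zero, and which strictly increases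
some positive vector, has an eigenvalue larger than one with a positive eigenvector. -/
lemma exists_pos_eigenvector [NeZero I] (hcol : ∀ j, (∀ i, 0 < M i j) ∨ ∀ i, M i j = 0)
    {w : Fin I → ℝ} (hw : ∀ i, 0 < w i) (hMw : ∀ i, w i < (M *ᵥ w) i) :
    ∃ ρ : ℝ, 1 < ρ ∧ ∃ v : Fin I → ℝ, (∀ i, 0 < v i) ∧ M *ᵥ v = ρ • v := by
  have hM : ∀ i j, 0 ≤ M i j := fun i j => by
    rcases hcol j with h | h
    · exact (h i).le
    · exact (h i).ge
  have hzero : ∀ {x : Fin I → ℝ}, (∀ j, (∀ i, 0 < M i j) → x j = 0) → M *ᵥ x = 0 :=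
    fun hx => mulVec_eq_zero_of_column fun j ⟨i, hi⟩ =>
      hx j ((hcol j).resolve_right fun h => hi (h i))
  have hw0 : w ≠ 0 := fun h => (hw 0).ne' (congrFun h 0)
  obtain ⟨ρ, -, ⟨x, hx, hx0, hρx⟩, hmax⟩ :=
    exists_maximal_subinvariant hM (fun i => (hw i).le) hw0 fun i => (hMw i).le
  have hρ : 1 < ρ := by
    obtain ⟨r, hr, h⟩ := exists_gt_of_forall_lt (r := 1) (y := w) (z := M *ᵥ w) (by simpa using hMw)
    exact hr.trans_le (hmax r hr.le w (fun i => (hw i).le) hw0 h)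
  -- The eigenvector will be `M *ᵥ x`, not `x`: the excess `y - ρ • x` may be nonzero on zero
  -- columns, and a further application of `M` kills it.
  set y := M *ᵥ x
  have hyx : ∀ i, ρ * x i ≤ y i := hρx
  have hy : ∀ i, 0 ≤ y i := fun i => (mul_nonneg (by linarith) (hx i)).trans (hyx i)
  have hy0 : y ≠ 0 := by
    obtain ⟨k, hk⟩ := Function.ne_iff.1 hx0
    intro h
    have h1 := hyx k
    rw [h] at h1
    have h2 : 0 < x k := lt_of_le_of_ne (hx k) (Ne.symm hk)
    have h3 : 0 < ρ * x k := mul_pos (by linarith) h2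
    exact absurd h1 (not_le.2 h3)
  have hMz : M *ᵥ (y - ρ • x) = M *ᵥ y - ρ • y := by
    rw [mulVec_sub, mulVec_smul]
  have hz : ∀ i, 0 ≤ (y - ρ • x) i := fun i => sub_nonneg.2 (hyx i)
  have heig : M *ᵥ y = ρ • y := by
    rw [← sub_eq_zero, ← hMz]
    refine hzero fun j hj => ?_
    by_contra hne
    -- An excess in a positive column would make `M *ᵥ y > ρ • y` everywhere, leaving room for a
    -- larger ratio and contradicting maximality.
    have hpos := mulVec_pos_of_column hM hz hj (lt_of_le_of_ne (hz j) (Ne.symm hne))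
    rw [hMz] at hpos
    obtain ⟨r, hr, h⟩ := exists_gt_of_forall_lt (r := ρ) (y := y) (z := M *ᵥ y)
      fun i => sub_pos.1 (hpos i)
    exact absurd (hmax r (hρ.trans hr).le y hy hy0 h) (not_le.2 hr)
  refine ⟨ρ, hρ, y, fun i => ?_, heig⟩
  obtain ⟨j, hj, hyj⟩ : ∃ j, (∀ i, 0 < M i j) ∧ y j ≠ 0 := by
    by_contra! h
    have h1 := hzero h
    rw [heig, smul_eq_zero] at h1
    exact h1.elim (fun h => by linarith) hy0
  have h1 := mulVec_pos_of_column hM hy hj (lt_of_le_of_ne (hy j) (Ne.symm hyj)) i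
  rw [heig] at h1
  exact (mul_pos_iff_of_pos_left (by linarith)).1 h1

/-- An eigenvalue of a nonnegative matrix that has a positive eigenvector dominates all other
eigenvalues if all columns are positive or zero. -/
lemma norm_lt_of_pos_eigenvector (hcol : ∀ j, (∀ i, 0 < M i j) ∨ ∀ i, M i j = 0)
    {ρ : ℝ} (hρ : 0 < ρ) {v : Fin I → ℝ} (hv : ∀ i, 0 < v i) (hMv : M *ᵥ v = ρ • v)
    {z : ℂ} {u : Fin I → ℂ} (hu : u ≠ 0) (hMu : M.map (algebraMap ℝ ℂ) *ᵥ u = z • u)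
    (hz : z ≠ ρ) : ‖z‖ < ρ := by
  have hM : ∀ i j, 0 ≤ M i j := fun i j => by
    rcases hcol j with h | h
    · exact (h i).le
    · exact (h i).ge
  by_contra! hle
  obtain ⟨k₀, hk₀⟩ := Function.ne_iff.1 hu
  -- At `k` the bound `‖u j‖ ≤ c * v j` is an equality. If `ρ ≤ ‖z‖`, row `k` of the eigenvalue
  -- equation then forces equality in the triangle inequality.
  obtain ⟨k, -, hk⟩ := Finset.exists_max_image Finset.univ (fun i => ‖u i‖ / v i)
    ⟨k₀, Finset.mem_univ k₀⟩
  set c := ‖u k‖ / v k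
  have hc : 0 < c := lt_of_lt_of_le (div_pos (norm_pos_iff.2 hk₀) (hv k₀)) (hk k₀ (Finset.mem_univ _))
  have huc : ∀ j, ‖u j‖ ≤ c * v j := fun j => (div_le_iff₀ (hv j)).1 (hk j (Finset.mem_univ j))
  have hck : ‖u k‖ = c * v k := (div_mul_cancel₀ _ (hv k).ne').symm
  have hMv' : ∀ i, ∑ j, M i j * v j = ρ * v i := fun i => congrFun hMv i
  have hMu' : ∀ i, ∑ j, (M i j : ℂ) * u j = z * u i := fun i => congrFun hMu i
  have hsum : ∑ j, M k j * (c * v j) = ρ * ‖u k‖ := by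
    simp_rw [mul_left_comm _ c]
    rw [← Finset.mul_sum, hMv', hck]
    ring
  have hzk : z * u k ≠ 0 := by
    refine mul_ne_zero ?_ ?_
    · exact norm_pos_iff.1 (hρ.trans_le hle)
    · exact norm_pos_iff.1 (hck ▸ mul_pos hc (hv k))
  set θ := z * u k / (‖z * u k‖ : ℂ)
  have hnorm : (‖z * u k‖ : ℂ) ≠ 0 := by exact_mod_cast (norm_pos_iff.2 hzk).ne'
  have hθ : ‖θ‖ = 1 := by
    simp only [θ, norm_div, Complex.norm_real, norm_norm]
    exact div_self (norm_pos_iff.2 hzk).ne'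
  have hθθ : θ * (starRingEnd ℂ) θ = 1 := by
    rw [Complex.mul_conj, Complex.normSq_eq_norm_sq, hθ]
    simp
  have hre : ∀ j, ((starRingEnd ℂ) θ * u j).re ≤ ‖u j‖ := fun j => by
    refine (Complex.re_le_norm _).trans ?_
    rw [norm_mul, Complex.norm_conj, hθ, one_mul]
  have hS : ‖z * u k‖ = ∑ j, M k j * ((starRingEnd ℂ) θ * u j).re := by
    have h1 : (starRingEnd ℂ) θ * (z * u k) = (‖z * u k‖ : ℂ) := by
      have : z * u k = θ * (‖z * u k‖ : ℂ) := (div_mul_cancel₀ _ hnorm).symm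
      refine (congrArg ((starRingEnd ℂ) θ * ·) this).trans ?_
      rw [← mul_assoc, mul_comm ((starRingEnd ℂ) θ), hθθ, one_mul]
    have h2 := congrArg Complex.re h1
    rw [← hMu', Complex.ofReal_re, Finset.mul_sum, Complex.re_sum] at h2
    rw [← hMu', ← h2]
    refine Finset.sum_congr rfl fun j _ => ?_
    rw [mul_left_comm, Complex.re_ofReal_mul]
  have hdiff : ∑ j, M k j * (c * v j - ((starRingEnd ℂ) θ * u j).re) ≤ 0 := by
    simp_rw [mul_sub]
    rw [Finset.sum_sub_distrib, hsum, ← hS, norm_mul]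
    exact sub_nonpos.2 (mul_le_mul_of_nonneg_right hle (norm_nonneg _))
  have hterm : ∀ j, 0 ≤ M k j * (c * v j - ((starRingEnd ℂ) θ * u j).re) := fun j =>
    mul_nonneg (hM k j) (sub_nonneg.2 ((hre j).trans (huc j)))
  have hall := (Finset.sum_eq_zero_iff_of_nonneg fun j _ => hterm j).1
    (le_antisymm hdiff (Finset.sum_nonneg fun j _ => hterm j))
  -- In positive columns equality forces `u` to be `c * v` rotated by the common phase `θ`. Zero
  -- columns do not contribute to `M u`, so `z * u` is known everywhere, and one positive column
  -- suffices to compare `z` with `ρ`.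
  have huj : ∀ j, (∀ i, 0 < M i j) → u j = θ * (c * v j : ℝ) := by
    intro j hj
    have h1 := (mul_eq_zero.1 (hall j (Finset.mem_univ j))).resolve_left (hj k).ne'
    have h2 : ((starRingEnd ℂ) θ * u j).re = c * v j := (sub_eq_zero.1 h1).symm
    have h3 : ‖(starRingEnd ℂ) θ * u j‖ ≤ c * v j := by
      rw [norm_mul, Complex.norm_conj, hθ, one_mul]; exact huc j
    have h4 : (starRingEnd ℂ) θ * u j = (c * v j : ℝ) := by
      have h5 := Complex.sq_norm_sub_sq_re ((starRingEnd ℂ) θ * u j)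
      rw [h2] at h5
      have h6 : ((starRingEnd ℂ) θ * u j).im = 0 := by
        have h7 : ‖(starRingEnd ℂ) θ * u j‖ ^ 2 ≤ (c * v j) ^ 2 :=
          pow_le_pow_left₀ (norm_nonneg _) h3 2
        have h8 : ((starRingEnd ℂ) θ * u j).im ^ 2 ≤ 0 := by linarith
        exact pow_eq_zero_iff two_ne_zero |>.1 (le_antisymm h8 (sq_nonneg _))
      exact Complex.ext (by rw [h2, Complex.ofReal_re]) (by rw [h6, Complex.ofReal_im])
    rw [← h4, ← mul_assoc, hθθ, one_mul]
  have hMu2 : ∀ i, z * u i = θ * (c * ρ * v i : ℝ) := by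
    intro i
    rw [← hMu']
    have h1 : ∀ j, (M i j : ℂ) * u j = θ * c * (M i j * v j : ℝ) := fun j => by
      rcases hcol j with h | h
      · rw [huj j h]; push_cast; ring
      · rw [h i]; simp
    simp_rw [h1]
    rw [← Finset.mul_sum, ← Complex.ofReal_sum, hMv']
    push_cast
    ring
  obtain ⟨j, hj⟩ : ∃ j, ∀ i, 0 < M i j := by
    by_contra! h
    have h1 : ∀ j, M k j = 0 := fun j =>
      (hcol j).resolve_left (fun h' => (h j).elim fun i hi => absurd (h' i) (not_lt.2 hi)) k
    have h2 := hMv' k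
    simp only [h1, zero_mul, Finset.sum_const_zero] at h2
    exact (mul_pos hρ (hv k)).ne h2
  have h1 := hMu2 j
  rw [huj j hj] at h1
  have hne : θ * (c * v j : ℝ) ≠ 0 := by
    refine mul_ne_zero (norm_pos_iff.1 (hθ ▸ one_pos)) ?_
    exact_mod_cast (mul_pos hc (hv j)).ne'
  refine hz (mul_right_cancel₀ hne (h1.trans ?_))
  push_cast
  ring

lemma exists_isPerronFrobeniusEigenvalue [NeZero I]
    (hcol : ∀ j, (∀ i, 0 < M i j) ∨ ∀ i, M i j = 0)
    {w : Fin I → ℝ} (hw : ∀ i, 0 < w i) (hMw : ∀ i, w i < ∑ j, M i j * w j) :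
    ∃ ρ, IsPerronFrobeniusEigenvalue M ρ ∧ 1 < ρ := by
  obtain ⟨ρ, hρ, v, hv, hMv⟩ := exists_pos_eigenvector hcol hw hMw
  have hρ0 : 0 < ρ := one_pos.trans hρ
  refine ⟨ρ, ⟨hρ0, ?_, fun z hz hne => ?_⟩, hρ⟩
  · refine Module.End.hasEigenvalue_of_hasEigenvector (x := v)
      ⟨Module.End.mem_eigenspace_iff.2 ?_, fun h => (hv 0).ne' (congrFun h 0)⟩
    rw [Matrix.toLin'_apply, hMv]
  · obtain ⟨u, hu⟩ := hz.exists_hasEigenvector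
    refine norm_lt_of_pos_eigenvector hcol hρ0 hv hMv hu.2 ?_ hne
    have := Module.End.mem_eigenspace_iff.1 hu.1
    rwa [Matrix.toLin'_apply] at this

end PerronFrobenius


/-! ### Survival of supercritical multitype branching processes -/

section Survival

variable {I : ℕ}

lemma prod_pow_sum {R ι : Type*} [CommMonoid R] (s : Fin I → R) (t : Finset ι)
    (f : ι → Fin I → ℕ) : ∏ j, s j ^ (∑ a ∈ t, f a) j = ∏ a ∈ t, ∏ j, s j ^ f a j := by
  simp_rw [Finset.sum_apply, ← Finset.prod_pow_eq_pow_sum]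
  exact Finset.prod_comm

variable {ν : Fin I → Measure (Fin I → ℕ)}

/-- The offspring of all individuals. -/
noncomputable abbrev offspringLaw (ν : Fin I → Measure (Fin I → ℕ)) :
    Measure (ℕ × Fin I × ℕ → Fin I → ℕ) :=
  Measure.infinitePi (fun p : ℕ × Fin I × ℕ => ν p.2.1)

/-- The σ-algebra generated by the offspring of one individual. -/
abbrev individual (p : ℕ × Fin I × ℕ) : MeasurableSpace (ℕ × Fin I × ℕ → Fin I → ℕ) :=
  MeasurableSpace.comap (fun y => y p) inferInstance

lemma individual_le (p : ℕ × Fin I × ℕ) : individual p ≤ MeasurableSpace.pi :=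
  (measurable_pi_apply p).comap_le

/-- The σ-algebra generated by the offspring of all individuals in `s`. -/
abbrev population (s : Set (ℕ × Fin I × ℕ)) : MeasurableSpace (ℕ × Fin I × ℕ → Fin I → ℕ) :=
  ⨆ p ∈ s, individual p

lemma measurable_population {s : Set (ℕ × Fin I × ℕ)} {p : ℕ × Fin I × ℕ} (hp : p ∈ s) :
    Measurable[population s] fun y : ℕ × Fin I × ℕ → Fin I → ℕ => y p :=
  measurable_iff_comap_le.2 (le_iSup₂_of_le (f := fun p (_ : p ∈ s) => individual p) p hp le_rfl)

lemma population_le (s : Set (ℕ × Fin I × ℕ)) : population s ≤ MeasurableSpace.pi :=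
  iSup₂_le fun p _ => individual_le p

lemma population_mono {s t : Set (ℕ × Fin I × ℕ)} (h : s ⊆ t) : population s ≤ population t :=
  biSup_mono h

lemma measurable_generation (i : Fin I) (n : ℕ) :
    Measurable[population {p | p.1 < n}] fun y => generation i y n := by
  induction n with
  | zero => exact measurable_const
  | succ n ih =>
    have ih' : Measurable[population {p : ℕ × Fin I × ℕ | p.1 < n + 1}]
        fun y => generation i y n :=
      ih.mono (population_mono fun p hp => Nat.lt_succ_of_lt hp) le_rfl
    simp only [generation]
    refine Finset.measurable_sum _ fun j _ => ?_
    refine @measurable_natComp _ (population {p : ℕ × Fin I × ℕ | p.1 < n + 1}) _ _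
      (fun N y => ∑ k ∈ Finset.range N, y (n, j, k)) (fun N => ?_) _
      ((measurable_pi_apply j).comp ih')
    exact Finset.measurable_sum _ fun k _ => measurable_population (Nat.lt_succ_self n)

lemma measurableSet_generation_eq (i : Fin I) (n : ℕ) (z : Fin I → ℕ) :
    MeasurableSet[population {p | p.1 < n}] {y | generation i y n = z} :=
  measurable_generation i n (measurableSet_singleton z)

variable [∀ j, IsProbabilityMeasure (ν j)]

lemma iIndepFun_offspring : iIndepFun (fun (p : ℕ × Fin I × ℕ)
    (y : ℕ × Fin I × ℕ → Fin I → ℕ) => y p) (offspringLaw ν) :=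
  iIndepFun_infinitePi (X := fun _ k => k) fun _ => measurable_id

lemma iIndepFun_comp_offspring {f : (Fin I → ℕ) → ENNReal} (hf : Measurable f) :
    iIndepFun (fun (p : ℕ × Fin I × ℕ) (y : ℕ × Fin I × ℕ → Fin I → ℕ) => f (y p))
      (offspringLaw ν) :=
  iIndepFun_offspring.comp (fun _ => f) fun _ => hf

/-- For a fixed generation `z`, the offspring vectors of its individuals are independent, so the
generating function of their sum factorises. -/
lemma lintegral_prod_offspring (s : Fin I → ENNReal) (n : ℕ) (z : Fin I → ℕ) :
    ∫⁻ y, ∏ l, s l ^ (∑ j, ∑ k ∈ Finset.range (z j), y (n, j, k)) l ∂(offspringLaw ν) =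
      ∏ j, (∫⁻ k, ∏ l, s l ^ k l ∂(ν j)) ^ z j := by
  have hφ : Measurable fun k : Fin I → ℕ => ∏ l, s l ^ k l := Measurable.of_discrete
  have hg : Function.Injective fun a : (_ : Fin I) × ℕ => (n, a.1, a.2) := by
    rintro ⟨j, k⟩ ⟨j', k'⟩ h
    simp only [Prod.mk.injEq, true_and] at h
    obtain ⟨rfl, rfl⟩ := h
    rfl
  have hind' : iIndepFun (fun (a : (_ : Fin I) × ℕ) (y : ℕ × Fin I × ℕ → Fin I → ℕ) =>
      ∏ l, s l ^ y (n, a.1, a.2) l) (offspringLaw ν) :=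
    (iIndepFun_comp_offspring hφ).precomp hg
  have hprod := lintegral_prod_eq_prod_lintegral_of_indepFun
    (Finset.univ.sigma fun j => Finset.range (z j)) _ hind'
    fun a => hφ.comp (measurable_pi_apply _)
  simp only [Finset.prod_sigma] at hprod
  simp_rw [prod_pow_sum]
  rw [hprod]
  refine Finset.prod_congr rfl fun j _ => ?_
  have h1 : ∀ k, ∫⁻ y, ∏ l, s l ^ y (n, j, k) l ∂(offspringLaw ν) =
      ∫⁻ k, ∏ l, s l ^ k l ∂(ν j) := fun k => by
    have := (measurePreserving_eval_infinitePi (fun p : ℕ × Fin I × ℕ => ν p.2.1)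
      (n, j, k)).lintegral_comp hφ
    exact this
  simp [h1]

/-- Conditioning on generation `n`, which depends only on offspring of earlier generations, replaces
`s` by its image under the generating functions; this image is at most `s`, so the expectations
decrease in `n`. -/
lemma lintegral_prod_generation_le {s : Fin I → ENNReal}
    (hs : ∀ j, ∫⁻ k, ∏ l, s l ^ k l ∂(ν j) ≤ s j) (i : Fin I) (n : ℕ) :
    ∫⁻ y, ∏ l, s l ^ generation i y n l ∂(offspringLaw ν) ≤ s i := by
  have hgen : ∀ n z, MeasurableSet {y : ℕ × Fin I × ℕ → Fin I → ℕ | generation i y n = z} :=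
    fun n z => population_le _ _ (measurableSet_generation_eq i n z)
  have hsplit : ∀ (f : (Fin I → ℕ) → (ℕ × Fin I × ℕ → Fin I → ℕ) → ENNReal),
      (∀ z, Measurable (f z)) → ∀ n, ∫⁻ y, f (generation i y n) y ∂(offspringLaw ν) =
        ∑' z, ∫⁻ y, {y | generation i y n = z}.indicator (f z) y ∂(offspringLaw ν) := by
    intro f hf n
    rw [← lintegral_tsum fun z => ((hf z).indicator
      (hgen n z)).aemeasurable]
    refine lintegral_congr fun y => ?_
    rw [tsum_eq_single (generation i y n)]
    · exact (Set.indicator_of_mem (s := {y' | generation i y' n = generation i y n}) rfl _).symm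
    · exact fun z hz => Set.indicator_of_notMem (fun h => hz h.symm) _
  induction n with
  | zero =>
    have : ∏ l, s l ^ (Pi.single i 1 : Fin I → ℕ) l = s i := by
      rw [Finset.prod_eq_single i]
      · simp
      · intro j _ hj; simp [hj]
      · simp
    simp [generation, this]
  | succ n ih =>
    refine le_trans ?_ ih
    have hmeas : ∀ z : Fin I → ℕ, Measurable[population {p | p.1 = n}]
        fun y : ℕ × Fin I × ℕ → Fin I → ℕ =>
          ∏ l, s l ^ (∑ j, ∑ k ∈ Finset.range (z j), y (n, j, k)) l := fun z => by
      refine (Measurable.of_discrete (f := fun k : Fin I → ℕ => ∏ l, s l ^ k l)).comp ?_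
      exact Finset.measurable_sum _ fun j _ => Finset.measurable_sum _ fun k _ =>
        measurable_population rfl
    have hind : Indep (population {p | p.1 = n}) (population {p | p.1 < n}) (offspringLaw ν) := by
      refine indep_iSup_of_disjoint individual_le
        iIndepFun_offspring.iIndep ?_
      exact Set.disjoint_left.2 fun p hp hp' => (ne_of_lt hp') hp
    have h1 := hsplit (fun z y => ∏ l, s l ^ (∑ j, ∑ k ∈ Finset.range (z j), y (n, j, k)) l)
      (fun z => (hmeas z).mono (population_le _) le_rfl) n
    have h2 := hsplit (fun z _ => ∏ l, s l ^ z l) (fun z => measurable_const) n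
    simp only [generation] at h1 h2 ⊢
    rw [h1, h2]
    refine ENNReal.tsum_le_tsum fun z => ?_
    rw [lintegral_indicator_of_indep (population_le _) (population_le _) (hmeas z) hind
      (measurableSet_generation_eq i n z), lintegral_prod_offspring,
      lintegral_indicator_const (hgen n z)]
    exact mul_le_mul_left (Finset.prod_le_prod' fun j _ => pow_le_pow_left' (hs j) _) _

/-- A subsolution of the generating function equation bounds the extinction probabilities. -/
lemma extinctionProb_le {s : Fin I → ENNReal}
    (hs : ∀ j, ∫⁻ k, ∏ l, s l ^ k l ∂(ν j) ≤ s j) (i : Fin I) (hi : s i ≠ ⊤) :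
    extinctionProb ν i ≤ (s i).toReal := by
  refine ENNReal.toReal_mono hi ?_
  have hunion : {y : ℕ × Fin I × ℕ → Fin I → ℕ | ∃ n, generation i y n = 0} =
      ⋃ n, {y | generation i y n = 0} := by
    ext y; simp
  have hmono : Monotone fun n => {y : ℕ × Fin I × ℕ → Fin I → ℕ | generation i y n = 0} := by
    refine monotone_nat_of_le_succ fun n y hy => ?_
    have hy' : generation i y n = 0 := hy
    simp [generation, hy']
  rw [hunion, hmono.measure_iUnion]
  refine iSup_le fun n => (le_trans ?_ (lintegral_prod_generation_le hs i n))
  have hmeas : MeasurableSet {y : ℕ × Fin I × ℕ → Fin I → ℕ | generation i y n = 0} :=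
    population_le _ _ (measurableSet_generation_eq i n 0)
  rw [← lintegral_indicator_one hmeas]
  -- On extinction by generation `n` the product has only zero exponents and equals one.
  refine lintegral_mono fun y => ?_
  by_cases hy : y ∈ {y | generation i y n = 0}
  · have hy' : generation i y n = 0 := hy
    rw [Set.indicator_of_mem hy]
    simp [hy']
  · rw [Set.indicator_of_notMem hy]
    exact zero_le

lemma one_sub_prod_le_sum {ι : Type*} (t : Finset ι) (u : ι → ℝ) (h0 : ∀ j, 0 ≤ u j)
    (h1 : ∀ j, u j ≤ 1) : 1 - ∏ j ∈ t, u j ≤ ∑ j ∈ t, (1 - u j) := by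
  induction t using Finset.cons_induction with
  | empty => simp
  | cons a t ha ih =>
    rw [Finset.prod_cons, Finset.sum_cons]
    have h2 : ∏ j ∈ t, u j ≤ 1 := Finset.prod_le_one (fun j _ => h0 j) fun j _ => h1 j
    nlinarith [mul_le_mul_of_nonneg_right (sub_nonneg.2 h2) (h0 a), h1 a, h0 a]

/-- Bernoulli's inequality in each factor. With `x = ε * w` and after division by `ε`, the bound is
free of `ε` and serves as the integrable majorant. -/
lemma one_sub_prod_pow_le {x : Fin I → ℝ} (h0 : ∀ j, 0 ≤ x j) (h1 : ∀ j, x j ≤ 1)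
    (k : Fin I → ℕ) : 1 - ∏ j, (1 - x j) ^ k j ≤ ∑ j, k j * x j := by
  refine (one_sub_prod_le_sum _ _ (fun j => pow_nonneg (sub_nonneg.2 (h1 j)) _)
    fun j => pow_le_one₀ (sub_nonneg.2 (h1 j)) (sub_le_self _ (h0 j))).trans
    (Finset.sum_le_sum fun j _ => ?_)
  have := one_add_mul_le_pow (a := -x j) (by linarith [h1 j]) (k j)
  rw [← sub_eq_add_neg] at this
  linarith

lemma tendsto_one_sub_prod_div (w : Fin I → ℝ) (k : Fin I → ℕ) :
    Filter.Tendsto (fun ε : ℝ => (1 - ∏ j, (1 - ε * w j) ^ k j) / ε) (nhdsWithin 0 (Set.Ioi 0))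
      (nhds (∑ j, k j * w j)) := by
  have h : HasDerivAt (fun ε : ℝ => ∏ j, (1 - ε * w j) ^ k j) (-∑ j, k j * w j) 0 := by
    have h1 : ∀ j ∈ Finset.univ, HasDerivAt (fun ε : ℝ => (1 - ε * w j) ^ k j)
        (-(k j * w j)) 0 := fun j _ => by
      have := ((((hasDerivAt_id (0 : ℝ)).mul_const (w j)).const_sub 1).fun_pow (k j))
      simpa using this
    have h2 := HasDerivAt.fun_finsetProd h1
    simpa using h2
  have h3 := (hasDerivAt_iff_tendsto_slope.1 h).neg.mono_left
    (nhdsWithin_mono (0 : ℝ) fun ε (hε : 0 < ε) => hε.ne')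
  rw [neg_neg] at h3
  refine h3.congr fun ε => ?_
  simp [slope_def_field]
  ring

lemma eventually_mul_le_one (w : Fin I → ℝ) :
    ∀ᶠ ε : ℝ in nhdsWithin 0 (Set.Ioi 0), 0 < ε ∧ ∀ j, ε * w j ≤ 1 := by
  refine Filter.Eventually.and (self_mem_nhdsWithin (s := Set.Ioi (0 : ℝ)))
    (Filter.eventually_all.2 fun j => ?_)
  have : ∀ᶠ ε : ℝ in nhds 0, ε * w j < 1 :=
    (continuous_id.mul continuous_const).continuousAt.eventually_lt continuousAt_const (by simp)
  exact (this.filter_mono nhdsWithin_le_nhds).mono fun _ h => h.le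

/-- First-order expansion of the generating function at `1`: by dominated convergence the difference
quotient tends to the mean of `∑ k j * w j`, which exceeds `b`. -/
lemma eventually_integral_prod_le {μ : Measure (Fin I → ℕ)} [IsProbabilityMeasure μ] {w : Fin I → ℝ}
    (hw : ∀ j, 0 < w j) (hint : ∀ j, Integrable (fun k => (k j : ℝ)) μ) {b : ℝ}
    (hb : b < ∑ j, (∫ k, (k j : ℝ) ∂μ) * w j) :
    ∀ᶠ ε : ℝ in nhdsWithin 0 (Set.Ioi 0), ∫ k, ∏ j, (1 - ε * w j) ^ k j ∂μ ≤ 1 - ε * b := by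
  have hsmall := eventually_mul_le_one w
  have hint' : Integrable (fun k : Fin I → ℕ => ∑ j, (k j : ℝ) * w j) μ :=
    integrable_finsetSum _ fun j _ => (hint j).mul_const _
  have hlim := tendsto_integral_filter_of_dominated_convergence (μ := μ)
    (l := nhdsWithin (0 : ℝ) (Set.Ioi 0))
    (F := fun ε k => (1 - ∏ j, (1 - ε * w j) ^ k j) / ε) (fun k : Fin I → ℕ => ∑ j, (k j : ℝ) * w j)
    (Filter.Eventually.of_forall fun ε => Measurable.of_discrete.aestronglyMeasurable)
    (hsmall.mono fun ε hε => Filter.Eventually.of_forall fun k => by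
      have h0 : ∀ j, 0 ≤ ε * w j := fun j => mul_nonneg hε.1.le (hw j).le
      have h1 : 0 ≤ 1 - ∏ j, (1 - ε * w j) ^ k j := sub_nonneg.2 (Finset.prod_le_one
        (fun j _ => pow_nonneg (sub_nonneg.2 (hε.2 j)) _)
        fun j _ => pow_le_one₀ (sub_nonneg.2 (hε.2 j)) (sub_le_self _ (h0 j)))
      rw [Real.norm_of_nonneg (div_nonneg h1 hε.1.le), div_le_iff₀ hε.1, Finset.sum_mul]
      refine (one_sub_prod_pow_le h0 hε.2 k).trans_eq (Finset.sum_congr rfl fun j _ => ?_)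
      ring)
    hint' (Filter.Eventually.of_forall fun k => tendsto_one_sub_prod_div w k)
  have hsum : ∫ k, ∑ j, (k j : ℝ) * w j ∂μ = ∑ j, (∫ k, (k j : ℝ) ∂μ) * w j := by
    rw [integral_finsetSum _ fun j _ => (hint j).mul_const _]
    simp_rw [integral_mul_const]
  rw [hsum] at hlim
  filter_upwards [hsmall, hlim.eventually_const_lt hb] with ε hε hlt
  have hprod : Integrable (fun k : Fin I → ℕ => ∏ j, (1 - ε * w j) ^ k j) μ := by
    refine Integrable.of_bound Measurable.of_discrete.aestronglyMeasurable 1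
      (Filter.Eventually.of_forall fun k => ?_)
    rw [Real.norm_of_nonneg (Finset.prod_nonneg fun j _ => pow_nonneg (sub_nonneg.2 (hε.2 j)) _)]
    exact Finset.prod_le_one (fun j _ => pow_nonneg (sub_nonneg.2 (hε.2 j)) _)
      fun j _ => pow_le_one₀ (sub_nonneg.2 (hε.2 j))
        (sub_le_self _ (mul_nonneg hε.1.le (hw j).le))
  rw [integral_div, integral_sub (integrable_const _) hprod, lt_div_iff₀ hε.1] at hlt
  simp at hlt
  linarith

/-- If the mean offspring matrix strictly increases some positive vector, then the multitype
branching process survives with positive probability. -/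
lemma extinctionProb_lt_one {w : Fin I → ℝ} (hw : ∀ j, 0 < w j)
    (hint : ∀ i j, Integrable (fun k => (k j : ℝ)) (ν i))
    (hMw : ∀ i, w i < ∑ j, (∫ k, (k j : ℝ) ∂(ν i)) * w j) (i : Fin I) :
    extinctionProb ν i < 1 := by
  have hsmall := eventually_mul_le_one w
  -- There are finitely many types, so one `ε` makes `1 - ε * w` a subsolution for all of them at
  -- once, with every coordinate below one.
  obtain ⟨ε, hle, hε, h1⟩ := ((Filter.eventually_all.2 fun i =>
    eventually_integral_prod_le hw (hint i) (hMw i)).and hsmall).exists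
  have h0 : ∀ j, 0 ≤ 1 - ε * w j := fun j => sub_nonneg.2 (h1 j)
  have key := extinctionProb_le (ν := ν) (s := fun j => ENNReal.ofReal (1 - ε * w j)) (fun j => ?_) i
    ENNReal.ofReal_ne_top
  · rw [ENNReal.toReal_ofReal (h0 i)] at key
    have := mul_pos hε (hw i)
    linarith
  · have h2 : ∀ k : Fin I → ℕ, ∏ l, ENNReal.ofReal (1 - ε * w l) ^ k l =
        ENNReal.ofReal (∏ l, (1 - ε * w l) ^ k l) := fun k => by
      rw [ENNReal.ofReal_prod_of_nonneg fun l _ => pow_nonneg (h0 l) _]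
      exact Finset.prod_congr rfl fun l _ => (ENNReal.ofReal_pow (h0 l) _).symm
    simp_rw [h2]
    rw [← ofReal_integral_eq_lintegral_ofReal]
    · exact ENNReal.ofReal_le_ofReal (hle j)
    · refine Integrable.of_bound Measurable.of_discrete.aestronglyMeasurable 1
        (Filter.Eventually.of_forall fun k => ?_)
      rw [Real.norm_of_nonneg (Finset.prod_nonneg fun j _ => pow_nonneg (h0 j) _)]
      exact Finset.prod_le_one (fun j _ => pow_nonneg (h0 j) _)
        fun j _ => pow_le_one₀ (h0 j) (sub_le_self _ (mul_nonneg hε.le (hw j).le))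
    · exact Filter.Eventually.of_forall fun k => Finset.prod_nonneg fun j _ => pow_nonneg (h0 j) _

end Survival

end Polling

/-! ### Extinction and return probabilities of the polling model. -/

namespace Polling.PollingModel

variable {I : ℕ} {Ω : Type*} [mΩ : MeasurableSpace Ω] {P : Measure Ω} {m : PollingModel I P}

lemma q_nonneg (m : PollingModel I P) (i : Fin I) : 0 ≤ m.q i := measureReal_nonneg

variable [IsProbabilityMeasure P]

lemma q_lt_one (hgam : ∀ i, m.gam i < 1) (hload : ∀ i, m.load i < 1)
    (hover : 1 < ∑ j, m.load j) (i : Fin I) : m.q i < 1 := by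
  have hmeas : ∀ i, Measurable (m.sessionOffspring i) := fun i => measurable_queueAt m _ 1
  have hprob : ∀ i, IsProbabilityMeasure (P.map (m.sessionOffspring i)) := fun i =>
    Measure.isProbabilityMeasure_map (hmeas i).aemeasurable
  have hcast : ∀ j : Fin I, Measurable fun k : Fin I → ℕ => (k j : ℝ) := fun j =>
    Measurable.of_discrete
  refine extinctionProb_lt_one (w := fun j => 1 / m.mu j) (fun j => one_div_pos.2 (m.mu_pos j))
    (fun i j => ?_) (fun i => ?_) i
  · exact (integrable_map_measure (hcast j).aestronglyMeasurable (hmeas i).aemeasurable).2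
      (integrable_sessionOffspring hload i j)
  · simp_rw [integral_map (hmeas i).aemeasurable (hcast _).aestronglyMeasurable]
    exact lt_sum_meanMatrix_mul hgam hload hover i

lemma prod_pow_lt_one {x : Fin I → ℝ} (h0 : ∀ i, 0 ≤ x i) (h1 : ∀ i, x i < 1) {k : Fin I → ℕ}
    (hk : k ≠ 0) : ∏ i, x i ^ k i < 1 := by
  obtain ⟨i, hi⟩ := Function.ne_iff.1 hk
  rw [← Finset.mul_prod_erase _ _ (Finset.mem_univ i)]
  refine lt_of_le_of_lt (mul_le_of_le_one_right (pow_nonneg (h0 i) _) ?_)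
    (pow_lt_one₀ (h0 i) (h1 i) hi)
  exact Finset.prod_le_one (fun j _ => pow_nonneg (h0 j) _) fun j _ => pow_le_one₀ (h0 j) (h1 j).le

/-- The immigration law has total mass one and charges some `k ≠ 0`, where the product of the `q i ^
k i` is strictly below one. -/
lemma qG_lt_one (hq : ∀ i, m.q i < 1) (hne : P {ω | m.queueAt 0 1 ω ≠ 0} ≠ 0) : m.qG < 1 := by
  have hmeas : ∀ k, MeasurableSet {ω | m.queueAt 0 1 ω = k} := fun k =>
    measurable_queueAt m 0 1 (measurableSet_singleton k)
  have hdisj : Pairwise (Function.onFun Disjoint fun k => {ω | m.queueAt 0 1 ω = k}) :=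
    fun k l hkl => Set.disjoint_left.2 fun ω hk hl => hkl ((Eq.symm hk).trans hl)
  have htsum : ∑' k, P {ω | m.queueAt 0 1 ω = k} = 1 := by
    rw [← measure_iUnion hdisj hmeas, ← measure_univ (μ := P)]
    congr 1
    exact Set.eq_univ_of_forall fun ω => Set.mem_iUnion.2 ⟨_, rfl⟩
  have hsummable : Summable m.immigration :=
    ENNReal.summable_toReal (by rw [htsum]; exact ENNReal.one_ne_top)
  have hsum : ∑' k, m.immigration k = 1 := by
    have := ENNReal.tsum_toReal_eq (f := fun k => P {ω | m.queueAt 0 1 ω = k})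
      fun k => measure_ne_top _ _
    rw [htsum, ENNReal.toReal_one] at this
    exact this.symm
  obtain ⟨k, hk, hGk⟩ : ∃ k, k ≠ 0 ∧ 0 < m.immigration k := by
    by_contra! h
    refine hne (measure_mono_null (t := ⋃ k : {k : Fin I → ℕ // k ≠ 0},
      {ω | m.queueAt 0 1 ω = k}) (fun ω hω => Set.mem_iUnion.2 ⟨⟨_, hω⟩, rfl⟩)
      (measure_iUnion_null fun k => ?_))
    exact (measureReal_eq_zero_iff).1 (le_antisymm (h k k.2) measureReal_nonneg)
  have hG : ∀ k, 0 ≤ m.immigration k := fun k => measureReal_nonneg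
  have hprod : ∀ k : Fin I → ℕ, ∏ i, m.q i ^ k i ≤ 1 := fun k =>
    Finset.prod_le_one (fun j _ => pow_nonneg (m.q_nonneg j) _)
      fun j _ => pow_le_one₀ (m.q_nonneg j) (hq j).le
  have hle : ∀ k, m.immigration k * ∏ i, m.q i ^ k i ≤ m.immigration k := fun k =>
    mul_le_of_le_one_right (hG k) (hprod k)
  rw [qG, ← hsum]
  refine Summable.tsum_lt_tsum (i := k) hle ?_
    (Summable.of_nonneg_of_le (fun k => mul_nonneg (hG k)
      (Finset.prod_nonneg fun j _ => pow_nonneg (m.q_nonneg j) _)) hle hsummable) hsummable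
  exact mul_lt_of_lt_one_right hGk (prod_pow_lt_one m.q_nonneg hq hk)

end Polling.PollingModel

theorem lemma2 {I : ℕ} {Ω : Type*} [MeasurableSpace Ω] {P : Measure Ω} [IsProbabilityMeasure P]
    (m : Polling.PollingModel I P)
    (hserved : ∀ i, P {ω | m.gate i 0 ω = 0} < 1)
    (hload : ∀ i, (m.lam i : ℝ) / m.mu i < 1)
    (hover : 1 < ∑ i, (m.lam i : ℝ) / m.mu i) :
    (∀ i j, Integrable (fun ω => (m.sessionOffspring i ω j : ℝ)) P) ∧
    (∃ ρ : ℝ, Polling.IsPerronFrobeniusEigenvalue m.meanMatrix ρ ∧ 1 < ρ) ∧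
    (∀ i, m.q i < 1) ∧
    m.qG < 1 := by
  have hI : NeZero I := ⟨by
    rintro rfl
    norm_num at hover⟩
  have hgam : ∀ i, m.gam i < 1 := fun i => m.gam_lt_one (hserved i) (hload i)
  have hq := Polling.PollingModel.q_lt_one hgam hload hover
  exact ⟨Polling.PollingModel.integrable_sessionOffspring hload,
    Polling.exists_isPerronFrobeniusEigenvalue (Polling.PollingModel.meanMatrix_column hgam hload)
      (fun j => one_div_pos.2 (m.mu_pos j))
      (Polling.PollingModel.lt_sum_meanMatrix_mul hgam hload hover),
    hq, Polling.PollingModel.qG_lt_one hq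
      (Polling.PollingModel.measure_queueAt_zero_ne_zero hgam hload hover)⟩
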